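/- **Setting.** Let $R,T_0>0$, $\delta=2$, and for $T>0$ put $e_{tr}(T)=\frac32RT$, $e_{rot}(T)=\frac\delta2RT$, $e_{vib}(T)=\frac{RT_0}{\exp(T_0/T)-1}$, $e=e_{tr}+e_{rot}+e_{vib}$, $c_v^{\alpha}=\frac{de_\alpha}{dT}$. Let $\mu,Z_{rot},Z_{vib}>0$ be functions of the translational temperature, $\tau_{\mathcal C}>0$ a function of the density and the translational temperature, and $\mathrm{Pr}$ the Prandtl number. For a triple $\mathbf F=(F,G,H)$ of positive functions of $v\in\mathbb R^3$ with $(1+|v|^2)F$, $G$, $H$ integrable, and $\langle\cdot\rangle_v=\int_{\mathbb R^3}\cdot\,dv$, define $\rho,u,E_{tr},E_{rot},E_{vib},\Theta$ by $$\rho=\langle F\rangle_v,\quad \rho u=\langle vF\rangle_v,\quad \rho E_{tr}=\langle\tfrac12|v-u|^2F\rangle_v,\quad \rho E_{rot}=\langle G\rangle_v,\quad \rho E_{vib}=\langle H\rangle_v,\quad \rho\Theta=\langle (v-u)\otimes(v-u)F\rangle_v,$$ the temperatures $T_\alpha=e_\alpha^{-1}(E_\alpha)$ ($\alpha=tr,rot,vib$)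 and $T_{eq}=e^{-1}(E_{tr}+E_{rot}+E_{vib})$, the relaxation time $\tau=\frac{\mu(T_{tr})}{\rho RT_{tr}\mathrm{Pr}}$, the ratios $\theta_\alpha=\frac{\tau}{Z_\alpha\tau_{\mathcal C}}$ ($\alpha=rot,vib$), and $$e_\alpha(T_\alpha^{rel})=e_\alpha(T_\alpha)+\theta_\alpha\,(e_\alpha(T_{tr})-e_\alpha(T_\alpha))\quad(\alpha=rot,vib),\qquad e_{tr}(T_{tr}^{rel})=e_{tr}(T_{tr})-\sum_{\alpha=rot,vib}\theta_\alpha\,(e_\alpha(T_{tr})-e_\alpha(T_\alpha)),$$ $$\Pi=RT_{tr}^{rel}I+\tfrac{\mathrm{Pr}-1}{\mathrm{Pr}}(\Theta-RT_{tr}I),\qquad \mathcal G_{tr}(v)=\frac{\rho}{\sqrt{\det(2\pi\Pi)}}\exp\!\big(-\tfrac12(v-u)^T\Pi^{-1}(v-u)\big),$$ $$\boldsymbol{\mathcal G}[\mathbf F]=\big(\mathcal G_{tr},\,e_{rot}(T_{rot}^{rel})\mathcal G_{tr},\,e_{vib}(T_{vib}^{rel})\mathcal G_{tr}\big),\qquad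 \mathcal M_{tr}(v)=\frac{\rho}{(2\pi RT_{eq})^{3/2}}\exp\!\Big(-\frac{|v-u|^2}{2RT_{eq}}\Big).$$ The reduced ES-BGK system is $\partial_t\mathbf F+v\cdot\nabla_x\mathbf F=\frac1\tau(\boldsymbol{\mathcal G}[\mathbf F]-\mathbf F)$. The entropy is $\mathcal H(\mathbf F)=\langle h(\mathbf F)\rangle_v$ with $$h(\mathbf F)=F\Big[\big(1+\tfrac\delta2\big)\log\frac{F}{G^{\delta/(2+\delta)}}+\log\frac{RT_0F}{RT_0F+H}\Big]+\frac{H}{RT_0}\log\frac{H}{RT_0F+H}.$$ **Conditions** (C): $\frac23<\mathrm{Pr}\le1$, $\theta_{rot}<1$, $\theta_{vib}<1$, $\kappa<1$, $\kappa<\frac{3}{\mathrm{Pr}}(\mathrm{Pr}-\frac23)$ and $\theta_{rot}+\theta_{vib}\le\frac35$, where $\kappa=\theta_{rot}\frac{c_v^{rot}}{c_v^{tr}}+\theta_{vib}\frac{c_v^{vib}(T_{tr})}{c_v^{tr}}$. **Proposition.** $\mathcal H$ is an entropy for the reduced ES-BGK system, in the following sense. 1. $h$ is convex on $(0,\infty)^3$.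 2. For every triple $\mathbf F$ as above that satisfies (C) and for which $\nabla_{\mathbf F}h(\mathbf F)\cdot\frac1\tau(\boldsymbol{\mathcal G}[\mathbf F]-\mathbf F)$ is integrable in $v$, $$\Big\langle \nabla_{\mathbf F}h(\mathbf F)\cdot\tfrac1\tau(\boldsymbol{\mathcal G}[\mathbf F]-\mathbf F)\Big\rangle_v\le0,$$ with equality if and only if $\mathbf F=(\mathcal M_{tr},\,e_{rot}(T_{eq})\mathcal M_{tr},\,e_{vib}(T_{eq})\mathcal M_{tr})$ for almost every $v$. 3. Let $U\subset\mathbb R\times\mathbb R^3$ be open and let $\mathbf F(t,x,v)$ be a classical solution of the reduced system on $U$: for $(t,x)\in U$, $\mathbf F(t,x,\cdot)$ is a triple as above, $\mathbf F$ is differentiable in $(t,x)$ for each $v$, and the equation holds. Suppose that (C) holds at every point of $U$, that $(1+|v|)h(\mathbf F(t,x,\cdot))$ is integrable for every $(t,x)\in U$, and that, locally uniformly in $(t,x)\in U$, $|\partial_th(\mathbf F)|+|v||\nabla_xh(\mathbf F)|$ is bounded by an integrable function of $v$. Then at every $(t,x)\in U$ the function $\mathcal H(\mathbf F)$ is differentiable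 in $t$, the flux $\langle v\,h(\mathbf F)\rangle_v$ is differentiable in $x$, the integrand on the right below is integrable in $v$, and $$\partial_t\mathcal H(\mathbf F)+\nabla_x\cdot\langle v\,h(\mathbf F)\rangle_v=\Big\langle \nabla_{\mathbf F}h(\mathbf F)\cdot\tfrac1\tau(\boldsymbol{\mathcal G}[\mathbf F]-\mathbf F)\Big\rangle_v\le0,$$ and the right-hand side vanishes if and only if $\mathbf F=(\mathcal M_{tr},\,e_{rot}(T_{eq})\mathcal M_{tr},\,e_{vib}(T_{eq})\mathcal M_{tr})$ for almost every $v$. -/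

import Mathlib

open Real MeasureTheory Topology

noncomputable section

namespace ESBGK

/-- The velocity (and position) space `ℝ³` with its Euclidean structure. -/
abbrev V : Type := EuclideanSpace ℝ (Fin 3)

/-- Number of rotational degrees of freedom of a diatomic molecule. -/
def δ : ℝ := 2

/-- Physical data of the model: gas constant `R` per unit mass, characteristic vibrational
temperature `T₀`, Prandtl number `Pr`, viscosity `μ` and collision numbers `Zrot`, `Zvib` as
functions of the translational temperature, and mean collision time `τC` as a function of the
mass density and of the translational temperature. -/
structure Model where
  R : ℝ
  T₀ : ℝ
  Pr : ℝ
  μ : ℝ → ℝ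
  Zrot : ℝ → ℝ
  Zvib : ℝ → ℝ
  τC : ℝ → ℝ → ℝ
  R_pos : 0 < R
  T₀_pos : 0 < T₀
  μ_pos : ∀ T, 0 < T → 0 < μ T
  Zrot_pos : ∀ T, 0 < T → 0 < Zrot T
  Zvib_pos : ∀ T, 0 < T → 0 < Zvib T
  τC_pos : ∀ ρ T, 0 < ρ → 0 < T → 0 < τC ρ T

namespace Model

variable (P : Model)

/-! ### Energies, inverse functions and specific heats -/

/-- Translational energy at temperature `T`. -/
def eTr (T : ℝ) : ℝ := 3 / 2 * P.R * T

/-- Rotational energy at temperature `T`. -/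
def eRot (T : ℝ) : ℝ := δ / 2 * P.R * T

/-- Vibrational energy (harmonic oscillator) at temperature `T`. -/
def eVib (T : ℝ) : ℝ := P.R * P.T₀ / (exp (P.T₀ / T) - 1)

/-- Total energy at temperature `T`. -/
def eTot (T : ℝ) : ℝ := P.eTr T + P.eRot T + P.eVib T

/-- Inverse of `eTr`. -/
def eTrInv (E : ℝ) : ℝ := 2 / (3 * P.R) * E

/-- Inverse of `eRot`. -/
def eRotInv (E : ℝ) : ℝ := 2 / (δ * P.R) * E

/-- Inverse of `eVib : (0,∞) → (0,∞)`. -/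
def eVibInv (E : ℝ) : ℝ := P.T₀ / log (1 + P.R * P.T₀ / E)

/-- Inverse of the increasing bijection `eTot : (0,∞) → (0,∞)`. -/
def eTotInv (E : ℝ) : ℝ := Function.invFunOn P.eTot (Set.Ioi 0) E

/-- Translational specific heat. -/
def cvTr (T : ℝ) : ℝ := deriv P.eTr T

/-- Rotational specific heat. -/
def cvRot (T : ℝ) : ℝ := deriv P.eRot T

/-- Vibrational specific heat. -/
def cvVib (T : ℝ) : ℝ := deriv P.eVib T

end Model

/-! ### Macroscopic quantities of a triple of reduced distributions

A reduced state is a function `W = (F, G, H)` of the velocity alone, with values in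
`ℝ × ℝ × ℝ`: `F = W.1`, `G = W.2.1`, `H = W.2.2`. -/

/-- Mass density `ρ = ⟨F⟩`. -/
def rho (W : V → ℝ × ℝ × ℝ) : ℝ := ∫ v, (W v).1

/-- Mean velocity `u`, with `ρ u = ⟨v F⟩`. -/
def vel (W : V → ℝ × ℝ × ℝ) : V := (1 / rho W) • ∫ v, (W v).1 • v

/-- Specific translational energy, `ρ E_tr = ⟨|v - u|² F / 2⟩`. -/
def energyTr (W : V → ℝ × ℝ × ℝ) : ℝ :=
  1 / rho W * ∫ v, 1 / 2 * ‖v - vel W‖ ^ 2 * (W v).1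

/-- Specific rotational energy, `ρ E_rot = ⟨G⟩`. -/
def energyRot (W : V → ℝ × ℝ × ℝ) : ℝ := 1 / rho W * ∫ v, (W v).2.1

/-- Specific vibrational energy, `ρ E_vib = ⟨H⟩`. -/
def energyVib (W : V → ℝ × ℝ × ℝ) : ℝ := 1 / rho W * ∫ v, (W v).2.2

/-- The tensor `Θ`, with `ρ Θ = ⟨(v - u) ⊗ (v - u) F⟩`. -/
def Theta (W : V → ℝ × ℝ × ℝ) : Matrix (Fin 3) (Fin 3) ℝ :=
  fun i j => 1 / rho W * ∫ v : V, (v i - vel W i) * (v j - vel W j) * (W v).1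

/-- Reduced states: positive distributions with finite mass and energies. -/
structure IsState (W : V → ℝ × ℝ × ℝ) : Prop where
  F_pos : ∀ v, 0 < (W v).1
  G_pos : ∀ v, 0 < (W v).2.1
  H_pos : ∀ v, 0 < (W v).2.2
  F_int : Integrable fun v => (1 + ‖v‖ ^ 2) * (W v).1
  G_int : Integrable fun v => (W v).2.1
  H_int : Integrable fun v => (W v).2.2

namespace Model

variable (P : Model)

/-- Translational temperature. -/
def Ttr (W : V → ℝ × ℝ × ℝ) : ℝ := P.eTrInv (energyTr W)

/-- Rotational temperature. -/
def Trot (W : V → ℝ × ℝ × ℝ) : ℝ := P.eRotInv (energyRot W)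

/-- Vibrational temperature. -/
def Tvib (W : V → ℝ × ℝ × ℝ) : ℝ := P.eVibInv (energyVib W)

/-- Equilibrium temperature. -/
def Teq (W : V → ℝ × ℝ × ℝ) : ℝ := P.eTotInv (energyTr W + energyRot W + energyVib W)

/-- Relaxation time `τ = μ / (ρ R T_tr Pr)`. -/
def tau (W : V → ℝ × ℝ × ℝ) : ℝ := P.μ (P.Ttr W) / (rho W * P.R * P.Ttr W * P.Pr)

/-- The ratio `τ / (Z_rot τ_C)`. -/
def thetaRot (W : V → ℝ × ℝ × ℝ) : ℝ :=
  P.tau W / (P.Zrot (P.Ttr W) * P.τC (rho W) (P.Ttr W))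

/-- The ratio `τ / (Z_vib τ_C)`. -/
def thetaVib (W : V → ℝ × ℝ × ℝ) : ℝ :=
  P.tau W / (P.Zvib (P.Ttr W) * P.τC (rho W) (P.Ttr W))

/-! ### The relaxation Gaussian -/

/-- Relaxation rotational energy `e_rot(T_rot^rel)`. -/
def eRotRel (W : V → ℝ × ℝ × ℝ) : ℝ :=
  P.eRot (P.Trot W) + P.thetaRot W * (P.eRot (P.Ttr W) - P.eRot (P.Trot W))

/-- Relaxation vibrational energy `e_vib(T_vib^rel)`. -/
def eVibRel (W : V → ℝ × ℝ × ℝ) : ℝ :=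
  P.eVib (P.Tvib W) + P.thetaVib W * (P.eVib (P.Ttr W) - P.eVib (P.Tvib W))

/-- Relaxation translational energy `e_tr(T_tr^rel)`. -/
def eTrRel (W : V → ℝ × ℝ × ℝ) : ℝ :=
  P.eTr (P.Ttr W) - P.thetaRot W * (P.eRot (P.Ttr W) - P.eRot (P.Trot W))
    - P.thetaVib W * (P.eVib (P.Ttr W) - P.eVib (P.Tvib W))

/-- Relaxation translational temperature. -/
def TtrRel (W : V → ℝ × ℝ × ℝ) : ℝ := P.eTrInv (P.eTrRel W)

/-- Relaxation tensor `Π = R T_tr^rel I + (Pr - 1)/Pr (Θ - R T_tr I)`. -/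
def Pi (W : V → ℝ × ℝ × ℝ) : Matrix (Fin 3) (Fin 3) ℝ :=
  (P.R * P.TtrRel W) • (1 : Matrix (Fin 3) (Fin 3) ℝ)
    + ((P.Pr - 1) / P.Pr) • (Theta W - (P.R * P.Ttr W) • (1 : Matrix (Fin 3) (Fin 3) ℝ))

/-- The Gaussian `𝒢_tr` of mass `ρ`, mean `u` and covariance `Π`. -/
def Gtr (W : V → ℝ × ℝ × ℝ) (v : V) : ℝ :=
  rho W / √(((2 * π) • P.Pi W).det) *
    exp (-(1 / 2) * ((v - vel W).ofLp ⬝ᵥ ((P.Pi W)⁻¹.mulVec (v - vel W).ofLp)))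

/-- The relaxation state `(𝒢_tr, e_rot(T_rot^rel) 𝒢_tr, e_vib(T_vib^rel) 𝒢_tr)`. -/
def relaxed (W : V → ℝ × ℝ × ℝ) (v : V) : ℝ × ℝ × ℝ :=
  (P.Gtr W v, P.eRotRel W * P.Gtr W v, P.eVibRel W * P.Gtr W v)

/-- Collision operator of the reduced model. -/
def collision (W : V → ℝ × ℝ × ℝ) (v : V) : ℝ × ℝ × ℝ :=
  (1 / P.tau W) • (P.relaxed W v - W v)

/-! ### Equilibrium -/

/-- Translational Maxwellian `M_tr` of mass `ρ`, mean `u` and temperature `T_eq`. -/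
def Mtr (W : V → ℝ × ℝ × ℝ) (v : V) : ℝ :=
  rho W / (2 * π * P.R * P.Teq W) ^ (3 / 2 : ℝ) *
    exp (-(‖v - vel W‖ ^ 2 / (2 * P.R * P.Teq W)))

/-- Equilibrium triple `(M_tr, e_rot(T_eq) M_tr, e_vib(T_eq) M_tr)`. -/
def equilibrium (W : V → ℝ × ℝ × ℝ) (v : V) : ℝ × ℝ × ℝ :=
  (P.Mtr W v, P.eRot (P.Teq W) * P.Mtr W v, P.eVib (P.Teq W) * P.Mtr W v)

/-! ### Conditions on the parameters -/

/-- All the conditions under which the relaxation energies are positive, `Π` is positive definite,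
and the H-theorem holds. -/
structure Conditions (W : V → ℝ × ℝ × ℝ) : Prop where
  Pr_lower : 2 / 3 < P.Pr
  Pr_upper : P.Pr ≤ 1
  rot_lt : P.thetaRot W < 1
  vib_lt : P.thetaVib W < 1
  tr_lt : P.thetaRot W * (P.cvRot (P.Ttr W) / P.cvTr (P.Ttr W))
    + P.thetaVib W * (P.cvVib (P.Ttr W) / P.cvTr (P.Ttr W)) < 1
  Pi_lt : P.thetaRot W * (P.cvRot (P.Ttr W) / P.cvTr (P.Ttr W))
    + P.thetaVib W * (P.cvVib (P.Ttr W) / P.cvTr (P.Ttr W)) < 3 / P.Pr * (P.Pr - 2 / 3)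
  sum_le : P.thetaRot W + P.thetaVib W ≤ 3 / 5

/-! ### Entropy -/

/-- The entropy density `h(F, G, H)`. -/
def h (p : ℝ × ℝ × ℝ) : ℝ :=
  p.1 * ((1 + δ / 2) * log (p.1 / p.2.1 ^ (δ / (2 + δ)))
      + log (P.R * P.T₀ * p.1 / (P.R * P.T₀ * p.1 + p.2.2)))
    + p.2.2 / (P.R * P.T₀) * log (p.2.2 / (P.R * P.T₀ * p.1 + p.2.2))

/-- The entropy `ℋ(W) = ⟨h(W)⟩`. -/
def entropy (W : V → ℝ × ℝ × ℝ) : ℝ := ∫ v, P.h (W v)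

/-- The entropy flux `⟨v h(W)⟩`. -/
def entropyFlux (W : V → ℝ × ℝ × ℝ) : V := ∫ v, P.h (W v) • v

/-- The integrand `∇h(W) · (1/τ)(𝒢[W] - W)` of the entropy production. -/
def productionDensity (W : V → ℝ × ℝ × ℝ) (v : V) : ℝ :=
  fderiv ℝ P.h (W v) (P.collision W v)

/-- The entropy production `⟨∇h(W) · (1/τ)(𝒢[W] - W)⟩`. -/
def production (W : V → ℝ × ℝ × ℝ) : ℝ := ∫ v, P.productionDensity W v

/-! ### The reduced kinetic system -/

/-- Classical solutions of `∂ₜW + v · ∇ₓW = (1/τ)(𝒢[W] - W)` on a set `U` of points `(t, x)`. -/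
structure IsSolution (U : Set (ℝ × V)) (W : ℝ → V → V → ℝ × ℝ × ℝ) : Prop where
  state : ∀ t x, (t, x) ∈ U → IsState (W t x)
  diff : ∀ t x, (t, x) ∈ U → ∀ v, DifferentiableAt ℝ (fun q : ℝ × V => W q.1 q.2 v) (t, x)
  eqn : ∀ t x, (t, x) ∈ U → ∀ v,
    deriv (fun s => W s x v) t + fderiv ℝ (fun y => W t y v) x v = P.collision (W t x) v

/-- Finite entropy and entropy flux, and the local domination which makes the integrals
`⟨h(W)⟩` (in time) and `⟨v h(W)⟩` (in space) differentiable under the integral sign. -/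
structure EntropyRegular (U : Set (ℝ × V)) (W : ℝ → V → V → ℝ × ℝ × ℝ) : Prop where
  integrable : ∀ t x, (t, x) ∈ U → Integrable fun v => (1 + ‖v‖) * P.h (W t x v)
  dominated : ∀ p ∈ U, ∃ N ∈ 𝓝 p, ∃ g : V → ℝ, Integrable g ∧
    ∀ t x, (t, x) ∈ N → ∀ v,
      |deriv (fun s => P.h (W s x v)) t| + ‖v‖ * ‖fderiv ℝ (fun y => P.h (W t y v)) x‖ ≤ g v

end Model

/-- Divergence of a vector field on `ℝ³`. -/
def divergence (q : V → V) (x : V) : ℝ :=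
  ∑ j : Fin 3, (fderiv ℝ q x (EuclideanSpace.single j 1)) j

end ESBGK

end

/-! Write $g=\mathcal G[\mathbf F]$ and let $E$ be the Gaussian triple with the mass, mean velocity,
tensor $\Theta$ and internal energies of $\mathbf F$. With the Bregman distance
$B(q,p)=h(q)-h(p)-Dh(p)(q-p)$ and the Euler-type identity $Dh(p)p=h(p)+p_1$, one has pointwise in
$v$ $$Dh(\mathbf F)(g-\mathbf F)+B(g,\mathbf F)+B(\mathbf F,E)=Dh(g)g-g_1-Dh(E)\mathbf F+E_1.$$ The
differential of $h$ at a Gaussian triple is a quadratic polynomial in $v$, so the right side is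
integrable and its integral is the entropy difference of two Gaussian states, computable from
moments alone; $h(\mathbf F)$ itself need not be integrable. Since $B\ge0$ (this is also the
convexity of $h$), it remains to compare the two Gaussians.

That comparison (`gaussEntropy_relaxed_le`) splits in two. Anisotropy:
$\det\Pi\ge(T_{tr}^{rel}/T_{tr})^3\det\Theta$, an inequality between symmetric functions of
eigenvalues (`posDef_and_det_le`). Energy exchange: $\frac32\log T_{tr}$ plus the internal entropies
does not decrease (`entropy_le_relax`). By concavity the latter follows from the extreme cases where
one internal mode relaxes with ratio $3/5$; the vibrational case rests on the monotonicity of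
$RT-e_{vib}(T)$, that is, on $c_v^{vib}\le R$.

If the production vanishes, then $B(g,\mathbf F)=0$ almost everywhere, so $\mathbf F=g$, and
equating moments forces all temperatures to agree and $\Theta$ to be isotropic. The local balance is
the chain rule integrated in $v$, with the derivatives taken under the integral sign by domination.
-/

namespace ESBGK

/-! ### Bregman distance and convexity of the entropy density -/

/-- The open octant of positive triples. -/
def octant : Set (ℝ × ℝ × ℝ) := {p | 0 < p.1 ∧ 0 < p.2.1 ∧ 0 < p.2.2}

/-- `x - y ≤ x log (x/y)` written with a difference of logarithms. -/
theorem sub_le_mul_log_sub {x y : ℝ} (hx : 0 < x) (hy : 0 < y) :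
    x - y ≤ x * (log x - log y) := by
  have h1 := log_le_sub_one_of_pos (div_pos hy hx)
  rw [log_div hy.ne' hx.ne'] at h1
  have h2 : x * (y / x - 1) = y - x := by field_simp
  nlinarith [mul_le_mul_of_nonneg_left h1 hx.le]

theorem eq_of_mul_log_sub_eq {x y : ℝ} (hx : 0 < x) (hy : 0 < y)
    (h : x * (log x - log y) = x - y) : x = y := by
  by_contra hne
  have hne' : y / x ≠ 1 := fun h => hne ((div_eq_one_iff_eq hx.ne').mp h).symm
  have h1 := log_lt_sub_one_of_pos (div_pos hy hx) hne'
  rw [log_div hy.ne' hx.ne'] at h1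
  have h2 : x * (y / x - 1) = y - x := by field_simp
  nlinarith [mul_lt_mul_of_pos_left h1 hx]

/-- Tangent inequality for the vibrational part of the entropy density. -/
theorem vib_bregman_nonneg {a F H F₀ H₀ : ℝ} (ha : 0 < a) (hF : 0 < F) (hH : 0 < H)
    (hF₀ : 0 < F₀) (hH₀ : 0 < H₀) :
    0 ≤ F * (log (a * F) - log (a * F + H) - (log (a * F₀) - log (a * F₀ + H₀)))
      + H / a * (log H - log (a * F + H) - (log H₀ - log (a * F₀ + H₀))) := by
  have hN : 0 < a * F + H := by positivity
  have hN₀ : 0 < a * F₀ + H₀ := by positivity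
  -- The comparison values are $(F_0,H_0)$ rescaled so that $aF_0+H_0$ becomes $aF+H$; the linear
  -- terms then cancel, which is `h3`.
  have h1 := sub_le_mul_log_sub (x := F) (y := (a * F + H) * F₀ / (a * F₀ + H₀)) hF (by positivity)
  have h2 := sub_le_mul_log_sub (x := H) (y := (a * F + H) * H₀ / (a * F₀ + H₀)) hH (by positivity)
  rw [log_div (by positivity) hN₀.ne', log_mul hN.ne' hF₀.ne'] at h1
  rw [log_div (by positivity) hN₀.ne', log_mul hN.ne' hH₀.ne'] at h2
  rw [log_mul ha.ne' hF.ne', log_mul ha.ne' hF₀.ne']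
  have h3 : a * F + H - a * ((a * F + H) * F₀ / (a * F₀ + H₀))
      - (a * F + H) * H₀ / (a * F₀ + H₀) = 0 := by field_simp; ring
  have h4 : 0 ≤ a * (F * (log a + log F - log (a * F + H) - (log a + log F₀ - log (a * F₀ + H₀)))
      + H / a * (log H - log (a * F + H) - (log H₀ - log (a * F₀ + H₀)))) := by
    have : a * (H / a * (log H - log (a * F + H) - (log H₀ - log (a * F₀ + H₀))))
      = H * (log H - log (a * F + H) - (log H₀ - log (a * F₀ + H₀))) := by field_simp
    rw [mul_add, this]
    nlinarith [mul_le_mul_of_nonneg_left h1 ha.le]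
  exact nonneg_of_mul_nonneg_right h4 ha

theorem eq_of_vib_bregman_eq_zero {a F H F₀ H₀ : ℝ} (ha : 0 < a) (hF : 0 < F) (hH : 0 < H)
    (hF₀ : 0 < F₀) (hH₀ : 0 < H₀)
    (h : F * (log (a * F) - log (a * F + H) - (log (a * F₀) - log (a * F₀ + H₀)))
      + H / a * (log H - log (a * F + H) - (log H₀ - log (a * F₀ + H₀))) = 0) :
    H * F₀ = H₀ * F := by
  have hN : 0 < a * F + H := by positivity
  have hN₀ : 0 < a * F₀ + H₀ := by positivity
  have h1 := sub_le_mul_log_sub (x := F) (y := (a * F + H) * F₀ / (a * F₀ + H₀)) hF (by positivity)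
  have h2 := sub_le_mul_log_sub (x := H) (y := (a * F + H) * H₀ / (a * F₀ + H₀)) hH (by positivity)
  have h5 := eq_of_mul_log_sub_eq (x := F) (y := (a * F + H) * F₀ / (a * F₀ + H₀)) hF (by positivity)
  rw [log_div (by positivity) hN₀.ne', log_mul hN.ne' hF₀.ne'] at h1 h5
  rw [log_div (by positivity) hN₀.ne', log_mul hN.ne' hH₀.ne'] at h2
  rw [log_mul ha.ne' hF.ne', log_mul ha.ne' hF₀.ne'] at h
  have h3 : a * F + H - a * ((a * F + H) * F₀ / (a * F₀ + H₀))
      - (a * F + H) * H₀ / (a * F₀ + H₀) = 0 := by field_simp; ring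
  have h4 := congrArg (a * ·) h
  have : a * (H / a * (log H - log (a * F + H) - (log H₀ - log (a * F₀ + H₀))))
      = H * (log H - log (a * F + H) - (log H₀ - log (a * F₀ + H₀))) := by field_simp
  simp only [mul_add, this] at h4
  have h6 := mul_le_mul_of_nonneg_left h1 ha.le
  -- A zero sum forces equality in both logarithmic inequalities; the one for `F` already gives the
  -- proportionality.
  have h7 := h5 (mul_left_cancel₀ ha.ne' (by linarith))
  rw [eq_div_iff hN₀.ne'] at h7
  nlinarith

namespace Model

variable (P : Model)

/-- The constant `R T₀`. -/
noncomputable def vibScale : ℝ := P.R * P.T₀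

theorem vibScale_pos : 0 < P.vibScale := mul_pos P.R_pos P.T₀_pos

/-- The entropy density with all logarithms expanded. -/
theorem h_eq {p : ℝ × ℝ × ℝ} (hp : p ∈ octant) :
    P.h p = p.1 * (2 * log p.1 - log p.2.1
        + (log (P.vibScale * p.1) - log (P.vibScale * p.1 + p.2.2)))
      + p.2.2 / P.vibScale * (log p.2.2 - log (P.vibScale * p.1 + p.2.2)) := by
  obtain ⟨h1, h2, h3⟩ := hp
  have ha := P.vibScale_pos
  have hN : 0 < P.vibScale * p.1 + p.2.2 := by positivity
  unfold h δ
  change p.1 * (_ + log (P.vibScale * p.1 / (P.vibScale * p.1 + p.2.2)))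
    + p.2.2 / P.vibScale * log (p.2.2 / (P.vibScale * p.1 + p.2.2)) = _
  rw [log_div h1.ne' (by positivity), log_rpow h2, log_div (by positivity) hN.ne',
    log_div h3.ne' hN.ne']
  ring

/-- The partial derivative of the entropy density in `F`. -/
noncomputable def hF (p : ℝ × ℝ × ℝ) : ℝ :=
  2 * log p.1 + 2 - log p.2.1 + (log (P.vibScale * p.1) - log (P.vibScale * p.1 + p.2.2))

/-- The partial derivative of the entropy density in `H`. -/
noncomputable def hH (p : ℝ × ℝ × ℝ) : ℝ :=
  (log p.2.2 - log (P.vibScale * p.1 + p.2.2)) / P.vibScale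

theorem isOpen_octant : IsOpen octant := by
  have : octant = {p : ℝ × ℝ × ℝ | 0 < p.1} ∩ ({p | 0 < p.2.1} ∩ {p | 0 < p.2.2}) := rfl
  rw [this]
  exact (isOpen_lt (by fun_prop) (by fun_prop)).inter
    ((isOpen_lt (by fun_prop) (by fun_prop)).inter (isOpen_lt (by fun_prop) (by fun_prop)))

theorem differentiableAt_h {p : ℝ × ℝ × ℝ} (hp : p ∈ octant) : DifferentiableAt ℝ P.h p := by
  have ha := P.vibScale_pos
  have hev : P.h =ᶠ[𝓝 p] fun p => p.1 * (2 * log p.1 - log p.2.1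
        + (log (P.vibScale * p.1) - log (P.vibScale * p.1 + p.2.2)))
      + p.2.2 / P.vibScale * (log p.2.2 - log (P.vibScale * p.1 + p.2.2)) := by
    filter_upwards [isOpen_octant.mem_nhds hp] with q hq using P.h_eq hq
  refine DifferentiableAt.congr_of_eventuallyEq ?_ hev
  obtain ⟨h1, h2, h3⟩ := hp
  have hN : P.vibScale * p.1 + p.2.2 ≠ 0 := by positivity
  have hM : P.vibScale * p.1 ≠ 0 := by positivity
  fun_prop (disch := first | exact h1.ne' | exact h2.ne' | exact h3.ne' | assumption)

theorem fderiv_h {p : ℝ × ℝ × ℝ} (hp : p ∈ octant) (w : ℝ × ℝ × ℝ) :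
    fderiv ℝ P.h p w = P.hF p * w.1 - p.1 / p.2.1 * w.2.1 + P.hH p * w.2.2 := by
  have ha := P.vibScale_pos
  -- The directional derivative is computed along the line $p+sw$, where one-variable rules suffice,
  -- and then identified by uniqueness of derivatives.
  have hl : HasDerivAt (fun s : ℝ => p + s • w) w 0 := by
    simpa using ((hasDerivAt_id (0 : ℝ)).smul_const w).const_add p
  have hp0 : p + (0 : ℝ) • w = p := by simp
  have h0 : HasDerivAt (fun s : ℝ => P.h (p + s • w)) (fderiv ℝ P.h p w) 0 := by
    have := P.differentiableAt_h hp
    rw [← hp0] at this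
    have := this.hasFDerivAt.comp_hasDerivAt (0 : ℝ) hl
    rwa [hp0] at this
  have hev : (fun s : ℝ => P.h (p + s • w)) =ᶠ[𝓝 0] fun s =>
      (p.1 + s * w.1) * (2 * log (p.1 + s * w.1) - log (p.2.1 + s * w.2.1)
        + (log (P.vibScale * (p.1 + s * w.1))
          - log (P.vibScale * (p.1 + s * w.1) + (p.2.2 + s * w.2.2))))
      + (p.2.2 + s * w.2.2) / P.vibScale * (log (p.2.2 + s * w.2.2)
          - log (P.vibScale * (p.1 + s * w.1) + (p.2.2 + s * w.2.2))) := by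
    have : ∀ᶠ s : ℝ in 𝓝 0, p + s • w ∈ octant :=
      hl.continuousAt.eventually (by simp only [hp0]; exact isOpen_octant.mem_nhds hp)
    filter_upwards [this] with s hs using P.h_eq hs
  obtain ⟨h1, h2, h3⟩ := hp
  have hN : P.vibScale * p.1 + p.2.2 ≠ 0 := by positivity
  have lin : ∀ c d : ℝ, HasDerivAt (fun s : ℝ => c + s * d) d 0 := fun c d => by
    simpa using ((hasDerivAt_id (0 : ℝ)).mul_const d).const_add c
  have e1 := lin p.1 w.1
  have e2 := lin p.2.1 w.2.1
  have e3 := lin p.2.2 w.2.2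
  have e4 := (e1.const_mul P.vibScale)
  have e5 := e4.add e3
  have l1 := e1.log (by simpa using h1.ne')
  have l2 := e2.log (by simpa using h2.ne')
  have l3 := e3.log (by simpa using h3.ne')
  have l4 := e4.log (by simpa using ⟨ha.ne', h1.ne'⟩)
  have l5 := e5.log (by simpa using hN)
  have := ((e1.mul (((l1.const_mul 2).sub l2).add (l4.sub l5))).add
    ((e3.div_const P.vibScale).mul (l3.sub l5))).congr_of_eventuallyEq hev
  rw [h0.unique this]
  simp only [zero_mul, add_zero, Pi.add_apply, Pi.sub_apply, hF, hH]
  field_simp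
  ring

/-- The Bregman distance of the entropy density. -/
noncomputable def bregman (q p : ℝ × ℝ × ℝ) : ℝ := P.h q - P.h p - fderiv ℝ P.h p (q - p)

/-- For $\delta=2$ the density is $F\log F+F\log(F/G)$ plus the vibrational part. Each of the three
contributes its own Bregman distance, so nonnegativity and the equality case can be read off term by
term. -/
theorem bregman_eq {p q : ℝ × ℝ × ℝ} (hp : p ∈ octant) (hq : q ∈ octant) :
    P.bregman q p = (q.1 * (log q.1 - log p.1) - (q.1 - p.1))
      + (q.1 * (log q.1 - log (q.2.1 * (p.1 / p.2.1))) - (q.1 - q.2.1 * (p.1 / p.2.1)))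
      + (q.1 * (log (P.vibScale * q.1) - log (P.vibScale * q.1 + q.2.2)
          - (log (P.vibScale * p.1) - log (P.vibScale * p.1 + p.2.2)))
        + q.2.2 / P.vibScale * (log q.2.2 - log (P.vibScale * q.1 + q.2.2)
          - (log p.2.2 - log (P.vibScale * p.1 + p.2.2)))) := by
  rw [bregman, P.fderiv_h hp, P.h_eq hp, P.h_eq hq]
  have ha := P.vibScale_pos
  obtain ⟨h1, h2, h3⟩ := hp
  obtain ⟨k1, k2, k3⟩ := hq
  rw [log_mul k2.ne' (by positivity), log_div h1.ne' h2.ne']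
  simp only [hF, hH, Prod.fst_sub, Prod.snd_sub]
  field_simp
  ring

theorem bregman_nonneg {p q : ℝ × ℝ × ℝ} (hp : p ∈ octant) (hq : q ∈ octant) :
    0 ≤ P.bregman q p := by
  rw [P.bregman_eq hp hq]
  obtain ⟨h1, h2, h3⟩ := hp
  obtain ⟨k1, k2, k3⟩ := hq
  have e1 := sub_le_mul_log_sub k1 h1
  have e2 := sub_le_mul_log_sub k1 (mul_pos k2 (div_pos h1 h2))
  have e3 := vib_bregman_nonneg P.vibScale_pos k1 k3 h1 h3
  linarith

theorem eq_of_bregman_eq_zero {p q : ℝ × ℝ × ℝ} (hp : p ∈ octant) (hq : q ∈ octant)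
    (h : P.bregman q p = 0) : q = p := by
  rw [P.bregman_eq hp hq] at h
  obtain ⟨h1, h2, h3⟩ := hp
  obtain ⟨k1, k2, k3⟩ := hq
  have e1 := sub_le_mul_log_sub k1 h1
  have e2 := sub_le_mul_log_sub k1 (mul_pos k2 (div_pos h1 h2))
  have e3 := vib_bregman_nonneg P.vibScale_pos k1 k3 h1 h3
  have f1 : q.1 = p.1 := eq_of_mul_log_sub_eq k1 h1 (by linarith)
  have f2 := eq_of_mul_log_sub_eq k1 (mul_pos k2 (div_pos h1 h2)) (by linarith)
  have f3 := eq_of_vib_bregman_eq_zero P.vibScale_pos k1 k3 h1 h3 (by linarith)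
  rw [f1] at f2 f3
  refine Prod.ext f1 (Prod.ext ?_ (mul_right_cancel₀ h1.ne' f3))
  field_simp at f2
  linarith

theorem convex_octant : Convex ℝ octant := by
  rintro x ⟨x1, x2, x3⟩ y ⟨y1, y2, y3⟩ a b ha hb hab
  have key : ∀ s t : ℝ, 0 < s → 0 < t → 0 < a * s + b * t := fun s t hs ht => by
    rcases ha.eq_or_lt with rfl | ha
    · have : b = 1 := by linarith
      subst this; simpa using ht
    · positivity
  exact ⟨key _ _ x1 y1, key _ _ x2 y2, key _ _ x3 y3⟩

/-- The graph lies above its tangent plane at the intermediate point; in the weighted sum of the two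
tangent inequalities the linear terms cancel. -/
theorem convexOn_h : ConvexOn ℝ octant P.h := by
  refine ⟨convex_octant, fun x hx y hy a b ha hb hab => ?_⟩
  have hz := convex_octant hx hy ha hb hab
  have e1 := mul_le_mul_of_nonneg_left (P.bregman_nonneg hz hx) ha
  have e2 := mul_le_mul_of_nonneg_left (P.bregman_nonneg hz hy) hb
  simp only [bregman, map_sub, map_add, map_smul, smul_eq_mul, mul_zero] at e1 e2 ⊢
  set D := fderiv ℝ P.h (a • x + b • y)
  have : b = 1 - a := by linarith
  subst this
  nlinarith

end Model
end ESBGK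

/-! ### Symmetric matrices and moments of Gaussians -/

namespace ESBGK

open Matrix in
/-- Orthogonal diagonalization of a real symmetric matrix. -/
theorem exists_orthogonal_diagonalization {ι : Type*} [Fintype ι] [DecidableEq ι]
    {S : Matrix ι ι ℝ} (hS : S.IsHermitian) :
    ∃ (U : Matrix ι ι ℝ) (d : ι → ℝ), U * Uᵀ = 1 ∧ Uᵀ * U = 1 ∧ S = U * diagonal d * Uᵀ := by
  refine ⟨hS.eigenvectorUnitary, hS.eigenvalues, ?_, ?_, ?_⟩
  · exact (Unitary.mem_iff.mp hS.eigenvectorUnitary.2).2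
  · exact (Unitary.mem_iff.mp hS.eigenvectorUnitary.2).1
  · conv_lhs => rw [hS.spectral_theorem, Unitary.conjStarAlgAut_apply]
    rfl

open Matrix in
theorem posDef_conj_diagonal_iff {ι : Type*} [Fintype ι] [DecidableEq ι]
    {U : Matrix ι ι ℝ} (hU : U * Uᵀ = 1) (d : ι → ℝ) :
    (U * diagonal d * Uᵀ).PosDef ↔ ∀ i, 0 < d i := by
  have hu : IsUnit U := IsUnit.of_mul_eq_one _ hU
  have := Matrix.IsUnit.posDef_star_right_conjugate_iff (x := diagonal d) hu
  rw [posDef_diagonal_iff] at this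
  exact this

-- Take $A=U\sqrt D$ in a spectral decomposition. The substitution $x=Aw$ then reduces every
-- Gaussian integral to the standard one.
open Matrix in
theorem exists_eq_mul_transpose {ι : Type*} [Fintype ι] [DecidableEq ι]
    {S : Matrix ι ι ℝ} (hS : S.PosDef) : ∃ A : Matrix ι ι ℝ, S = A * Aᵀ ∧ A.det ≠ 0 := by
  obtain ⟨U, d, hU, -, rfl⟩ := exists_orthogonal_diagonalization hS.isHermitian
  have hd := (posDef_conj_diagonal_iff hU d).mp hS
  have e : U * diagonal d * Uᵀ = (U * diagonal fun i => √(d i))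
      * (U * diagonal fun i => √(d i))ᵀ := by
    rw [transpose_mul, diagonal_transpose, Matrix.mul_assoc U (diagonal _) (_ * _),
      ← Matrix.mul_assoc (diagonal _) (diagonal _), diagonal_mul_diagonal, ← Matrix.mul_assoc]
    simp_rw [mul_self_sqrt (hd _).le]
  refine ⟨_, e, fun h => ?_⟩
  have := hS.det_pos
  rw [e, det_mul, h, zero_mul] at this
  exact this.false

/-! ### Gaussian integrals -/

theorem integrable_exp_neg_half_sq : Integrable fun x : ℝ => exp (-x ^ 2 / 2) := by
  simpa [neg_div, div_eq_inv_mul] using integrable_exp_neg_mul_sq (b := 2⁻¹) (by norm_num)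

theorem integral_exp_neg_half_sq : ∫ x : ℝ, exp (-x ^ 2 / 2) = √(2 * π) := by
  have := integral_gaussian (2⁻¹)
  rw [div_inv_eq_mul, mul_comm π] at this
  rw [← this]
  congr 1 with x
  ring_nf

theorem integrable_mul_exp_neg_half_sq : Integrable fun x : ℝ => x * exp (-x ^ 2 / 2) := by
  simpa [neg_div, div_eq_inv_mul] using integrable_mul_exp_neg_mul_sq (b := 2⁻¹) (by norm_num)

theorem integral_mul_exp_neg_half_sq : ∫ x : ℝ, x * exp (-x ^ 2 / 2) = 0 := by
  have h := integral_neg_eq_self (fun x : ℝ => x * exp (-x ^ 2 / 2)) volume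
  simp only [even_two, Even.neg_pow, neg_mul, integral_neg] at h
  linarith

theorem integrable_sq_mul_exp_neg_half_sq : Integrable fun x : ℝ => x ^ 2 * exp (-x ^ 2 / 2) := by
  simpa [neg_div, div_eq_inv_mul] using
    integrable_rpow_mul_exp_neg_mul_sq (b := 2⁻¹) (by norm_num) (s := 2) (by norm_num)

theorem integral_sq_mul_exp_neg_half_sq : ∫ x : ℝ, x ^ 2 * exp (-x ^ 2 / 2) = √(2 * π) := by
  -- The second moment is read off from the variance of the standard Gaussian.
  have h := ProbabilityTheory.variance_fun_id_gaussianReal (μ := 0) (v := 1)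
  rw [ProbabilityTheory.variance_eq_integral measurable_id'.aemeasurable,
    ProbabilityTheory.integral_id_gaussianReal,
    ProbabilityTheory.integral_gaussianReal_eq_integral_smul (by norm_num)] at h
  simp only [ProbabilityTheory.gaussianPDFReal_def, sub_zero, NNReal.coe_one, mul_one,
    smul_eq_mul, mul_assoc] at h
  rw [integral_const_mul, inv_mul_eq_div, div_eq_one_iff_eq (by positivity)] at h
  rw [← h]
  congr 1 with x
  ring

theorem exp_neg_half_dotProduct {ι : Type*} [Fintype ι] (w : ι → ℝ) :
    exp (-(1 / 2) * (w ⬝ᵥ w)) = ∏ k, exp (-w k ^ 2 / 2) := by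
  rw [← exp_sum]
  congr 1
  simp only [dotProduct, Finset.mul_sum]
  exact Finset.sum_congr rfl fun i _ => by ring

open Matrix in
theorem mulVec_mul_mulVec {ι : Type*} [Fintype ι] (A : Matrix ι ι ℝ) (w : ι → ℝ) (i j : ι) :
    (A *ᵥ w) i * (A *ᵥ w) j = ∑ k, ∑ l, A i k * A j l * (w k * w l) := by
  simp only [mulVec, dotProduct, Finset.sum_mul_sum]
  exact Finset.sum_congr rfl fun k _ => Finset.sum_congr rfl fun l _ => by ring

section Multivariate

variable {ι : Type*} [Fintype ι]

theorem integral_exp_neg_half_dotProduct :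
    ∫ w : ι → ℝ, exp (-(1 / 2) * (w ⬝ᵥ w)) = √(2 * π) ^ Fintype.card ι := by
  simp_rw [exp_neg_half_dotProduct]
  rw [integral_fintype_prod_volume_eq_pow (fun x : ℝ => exp (-x ^ 2 / 2)),
    integral_exp_neg_half_sq]

theorem integrable_exp_neg_half_dotProduct :
    Integrable fun w : ι → ℝ => exp (-(1 / 2) * (w ⬝ᵥ w)) := by
  simp_rw [exp_neg_half_dotProduct]
  exact Integrable.fintype_prod fun _ => integrable_exp_neg_half_sq

variable [DecidableEq ι]

/-- Separating the variables lets Fubini reduce the second moments to one-dimensional integrals. -/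
theorem mul_mul_exp_neg_half_dotProduct (w : ι → ℝ) (i j : ι) :
    w i * w j * exp (-(1 / 2) * (w ⬝ᵥ w)) =
      ∏ k, (if k = i then w k else 1) * (if k = j then w k else 1) * exp (-w k ^ 2 / 2) := by
  rw [exp_neg_half_dotProduct, Finset.prod_mul_distrib, Finset.prod_mul_distrib]
  simp

theorem integrable_mul_mul_exp_neg_half_dotProduct (i j : ι) :
    Integrable fun w : ι → ℝ => w i * w j * exp (-(1 / 2) * (w ⬝ᵥ w)) := by
  simp_rw [mul_mul_exp_neg_half_dotProduct]
  refine Integrable.fintype_prod (f := fun k x => (if k = i then x else 1) *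
    (if k = j then x else 1) * exp (-x ^ 2 / 2)) fun k => ?_
  split_ifs
  · simpa [sq] using integrable_sq_mul_exp_neg_half_sq
  · simpa using integrable_mul_exp_neg_half_sq
  · simpa using integrable_mul_exp_neg_half_sq
  · simpa using integrable_exp_neg_half_sq

theorem integral_mul_mul_exp_neg_half_dotProduct (i j : ι) :
    ∫ w : ι → ℝ, w i * w j * exp (-(1 / 2) * (w ⬝ᵥ w)) =
      (1 : Matrix ι ι ℝ) i j * √(2 * π) ^ Fintype.card ι := by
  simp_rw [mul_mul_exp_neg_half_dotProduct]
  rw [integral_fintype_prod_volume_eq_prod (fun k x => (if k = i then x else 1) *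
    (if k = j then x else 1) * exp (-x ^ 2 / 2))]
  by_cases hij : i = j
  · subst hij
    rw [Matrix.one_apply_eq, one_mul, Fintype.card, ← Finset.prod_const]
    refine Finset.prod_congr rfl fun k _ => ?_
    by_cases h : k = i
    · simpa [h, ← sq] using integral_sq_mul_exp_neg_half_sq
    · simpa [h] using integral_exp_neg_half_sq
  · rw [Matrix.one_apply_ne hij, zero_mul]
    refine Finset.prod_eq_zero (Finset.mem_univ i) ?_
    simpa [hij] using integral_mul_exp_neg_half_sq

open Matrix in
theorem volume_eq_smul_map_mulVec {A : Matrix ι ι ℝ} (hA : A.det ≠ 0) :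
    (volume : Measure (ι → ℝ)) = ENNReal.ofReal |A.det| • Measure.map (toLin' A) volume := by
  rw [Real.map_matrix_volume_pi_eq_smul_volume_pi hA, smul_smul, ← ENNReal.ofReal_mul (abs_nonneg _),
    ← abs_mul, mul_inv_cancel₀ hA]
  simp

open Matrix in
theorem measurableEmbedding_toLin' {A : Matrix ι ι ℝ} (hA : A.det ≠ 0) :
    MeasurableEmbedding (toLin' A) := by
  have : A.det ≠ 0 → LinearMap.ker (toLin' A) = ⊥ := fun h => by
    rw [LinearMap.ker_eq_bot]
    exact Matrix.mulVec_injective_of_isUnit ((Matrix.isUnit_iff_isUnit_det _).mpr h.isUnit)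
  exact ((toLin' A).isClosedEmbedding_of_injective (this hA)).measurableEmbedding

open Matrix in
theorem integral_comp_mulVec {A : Matrix ι ι ℝ} (hA : A.det ≠ 0) (φ : (ι → ℝ) → ℝ) :
    ∫ x, φ x = |A.det| * ∫ w, φ (A *ᵥ w) := by
  conv_lhs => rw [volume_eq_smul_map_mulVec hA]
  rw [integral_smul_measure, (measurableEmbedding_toLin' hA).integral_map,
    ENNReal.toReal_ofReal (abs_nonneg _)]
  simp

open Matrix in
theorem integrable_of_comp_mulVec {A : Matrix ι ι ℝ} (hA : A.det ≠ 0) {φ : (ι → ℝ) → ℝ}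
    (h : Integrable fun w => φ (A *ᵥ w)) : Integrable φ := by
  rw [volume_eq_smul_map_mulVec hA]
  refine Integrable.smul_measure ?_ ENNReal.ofReal_ne_top
  rw [(measurableEmbedding_toLin' hA).integrable_map_iff]
  simpa [Function.comp_def] using h

open Matrix in
theorem mulVec_dotProduct_inv_mulVec {A : Matrix ι ι ℝ} (hA : A.det ≠ 0) (w : ι → ℝ) :
    (A *ᵥ w) ⬝ᵥ ((A * Aᵀ)⁻¹ *ᵥ (A *ᵥ w)) = w ⬝ᵥ w := by
  have h1 : (A * Aᵀ)⁻¹ * A = Aᵀ⁻¹ := by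
    rw [Matrix.mul_inv_rev, Matrix.mul_assoc, nonsing_inv_mul _ hA.isUnit, Matrix.mul_one]
  rw [mulVec_mulVec, h1, dotProduct_comm, dotProduct_mulVec, ← mulVec_transpose, mulVec_mulVec,
    ← transpose_nonsing_inv, ← transpose_mul, nonsing_inv_mul _ hA.isUnit, transpose_one, one_mulVec]

/-- The normalized Gaussian density on `ι → ℝ` with covariance `S`. -/
noncomputable def gaussianDensity (S : Matrix ι ι ℝ) (x : ι → ℝ) : ℝ :=
  1 / √(((2 * π) • S).det) * exp (-(1 / 2) * (x ⬝ᵥ (S⁻¹.mulVec x)))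

open Matrix in
theorem gaussianDensity_mulVec {A : Matrix ι ι ℝ} (hA : A.det ≠ 0) (w : ι → ℝ) :
    gaussianDensity (A * Aᵀ) (A *ᵥ w)
      = 1 / (√(2 * π) ^ Fintype.card ι * |A.det|) * exp (-(1 / 2) * (w ⬝ᵥ w)) := by
  rw [gaussianDensity, mulVec_dotProduct_inv_mulVec hA, det_smul, det_mul, det_transpose,
    sqrt_mul (by positivity), sqrt_mul_self_eq_abs]
  congr 3
  rw [sqrt_eq_iff_mul_self_eq (by positivity) (by positivity), ← mul_pow,
    mul_self_sqrt (by positivity)]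

theorem gaussianDensity_pos {S : Matrix ι ι ℝ} (hS : S.PosDef) (x : ι → ℝ) :
    0 < gaussianDensity S x := by
  have := (hS.smul (show (0 : ℝ) < 2 * π by positivity)).det_pos
  unfold gaussianDensity
  positivity

theorem integrable_gaussianDensity {S : Matrix ι ι ℝ} (hS : S.PosDef) :
    Integrable (gaussianDensity S) := by
  obtain ⟨A, rfl, hA⟩ := exists_eq_mul_transpose hS
  refine integrable_of_comp_mulVec hA ?_
  simp_rw [gaussianDensity_mulVec hA]
  exact integrable_exp_neg_half_dotProduct.const_mul _

theorem integral_gaussianDensity {S : Matrix ι ι ℝ} (hS : S.PosDef) :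
    ∫ x, gaussianDensity S x = 1 := by
  obtain ⟨A, rfl, hA⟩ := exists_eq_mul_transpose hS
  rw [integral_comp_mulVec hA]
  simp_rw [gaussianDensity_mulVec hA]
  rw [integral_const_mul, integral_exp_neg_half_dotProduct]
  have := abs_pos.mpr hA
  field_simp

theorem integrable_mul_gaussianDensity {S : Matrix ι ι ℝ} (hS : S.PosDef) (i j : ι) :
    Integrable fun x => x i * x j * gaussianDensity S x := by
  obtain ⟨A, rfl, hA⟩ := exists_eq_mul_transpose hS
  refine integrable_of_comp_mulVec hA ?_
  simp_rw [gaussianDensity_mulVec hA, mulVec_mul_mulVec, Finset.sum_mul]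
  refine integrable_finsetSum _ fun k _ => integrable_finsetSum _ fun l _ => ?_
  refine ((integrable_mul_mul_exp_neg_half_dotProduct k l).const_mul
    (A i k * A j l * (1 / (√(2 * π) ^ Fintype.card ι * |A.det|)))).congr
    (ae_of_all _ fun w => ?_)
  ring

theorem integral_mul_gaussianDensity {S : Matrix ι ι ℝ} (hS : S.PosDef) (i j : ι) :
    ∫ x, x i * x j * gaussianDensity S x = S i j := by
  obtain ⟨A, rfl, hA⟩ := exists_eq_mul_transpose hS
  rw [integral_comp_mulVec hA]
  set c := 1 / (√(2 * π) ^ Fintype.card ι * |A.det|) with hc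
  have e : ∀ w, (A.mulVec w) i * (A.mulVec w) j * gaussianDensity (A * A.transpose) (A.mulVec w)
      = ∑ k, ∑ l, A i k * A j l * c * (w k * w l * exp (-(1 / 2) * (w ⬝ᵥ w))) := fun w => by
    rw [gaussianDensity_mulVec hA, mulVec_mul_mulVec, Finset.sum_mul]
    refine Finset.sum_congr rfl fun k _ => ?_
    rw [Finset.sum_mul]
    exact Finset.sum_congr rfl fun l _ => by ring
  have hi := fun k l => (integrable_mul_mul_exp_neg_half_dotProduct (ι := ι) k l).const_mul
    (A i k * A j l * c)
  simp_rw [e]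
  rw [integral_finsetSum _ fun k _ => integrable_finsetSum _ fun l _ => hi k l]
  simp_rw [integral_finsetSum _ fun l _ => hi _ l, integral_const_mul,
    integral_mul_mul_exp_neg_half_dotProduct, Matrix.one_apply]
  have := abs_pos.mpr hA
  simp only [ite_mul, one_mul, zero_mul, mul_ite, mul_zero, Finset.sum_ite_eq, Finset.mem_univ,
    if_true, Matrix.mul_apply, Matrix.transpose_apply, Finset.mul_sum, hc]
  refine Finset.sum_congr rfl fun k _ => ?_
  field_simp

end Multivariate

end ESBGK

namespace ESBGK

/-! ### The determinant of the relaxation tensor -/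

/-- Let $c_2,c_3$ be the elementary symmetric functions and $c_1=3$. From $c_2^2\ge3c_1c_3=9c_3$ and
$c_2\le3$ one gets $c_3\le1$ and $3c_3\le c_2$. The difference of the two sides is
$(1+m)\big(m^2(c_2-3c_3)+(1+m)(1-2m)(1-c_3)\big)$, where every term is nonnegative for $0\le
m\le\frac12$. -/
theorem prod_le_prod_one_sub_mul {x y z m : ℝ} (hx : 0 < x) (hy : 0 < y) (hz : 0 < z)
    (hs : x + y + z = 3) (hm : 0 ≤ m) (hm' : m ≤ 1 / 2) :
    x * y * z ≤ (1 - m * (x - 1)) * (1 - m * (y - 1)) * (1 - m * (z - 1)) := by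
  have hc3 : 0 < x * y * z := by positivity
  have hc2 : 0 < x * y + y * z + z * x := by positivity
  have h2 : 9 * (x * y * z) ≤ (x * y + y * z + z * x) ^ 2 := by
    have : 9 * (x * y * z) = 3 * (x + y + z) * (x * y * z) := by rw [hs]; ring
    rw [this]
    nlinarith [sq_nonneg (x * y - y * z), sq_nonneg (y * z - z * x), sq_nonneg (z * x - x * y)]
  have h3 : x * y + y * z + z * x ≤ 3 := by
    have : (x + y + z) ^ 2 = 9 := by rw [hs]; norm_num
    nlinarith [sq_nonneg (x - y), sq_nonneg (y - z), sq_nonneg (z - x)]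
  have h1 : x * y * z ≤ 1 := by nlinarith
  have h4 : 3 * (x * y * z) ≤ x * y + y * z + z * x := by
    refine le_of_sq_le_sq (by nlinarith) hc2.le
  have key : (1 - m * (x - 1)) * (1 - m * (y - 1)) * (1 - m * (z - 1)) - x * y * z
      = (1 + m) * (m ^ 2 * (x * y + y * z + z * x - 3 * (x * y * z))
        + (1 + m) * (1 - 2 * m) * (1 - x * y * z)) := by
    have : z = 3 - x - y := by linarith
    subst this
    ring
  have : 0 ≤ (1 + m) * (m ^ 2 * (x * y + y * z + z * x - 3 * (x * y * z))
        + (1 + m) * (1 - 2 * m) * (1 - x * y * z)) := by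
    have a1 : 0 ≤ x * y + y * z + z * x - 3 * (x * y * z) := by linarith
    have a2 : 0 ≤ 1 - x * y * z := by linarith
    have a3 : 0 ≤ 1 - 2 * m := by linarith
    positivity
  linarith

theorem prod_le_prod_add_mul_sub {d : Fin 3 → ℝ} (hd : ∀ i, 0 < d i) {L L' ν : ℝ} (hL : 0 < L)
    (hs : ∑ i, d i = 3 * L) (hL' : 0 < L') (hν : ν ≤ 0) (hν' : 0 ≤ L' + 2 * (ν * L)) :
    (L' / L) ^ 3 * ∏ i, d i ≤ ∏ i, (L' + ν * (d i - L)) := by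
  simp only [Fin.sum_univ_three, Fin.prod_univ_three] at hs ⊢
  have h := prod_le_prod_one_sub_mul (x := d 0 / L) (y := d 1 / L) (z := d 2 / L)
    -- The eigenvalues are normalized by their mean $L$; `hν'` is exactly $m\le\frac12$.
    (m := -(ν * L) / L') (div_pos (hd 0) hL) (div_pos (hd 1) hL) (div_pos (hd 2) hL)
    (by rw [← add_div, ← add_div, hs]; field_simp) (div_nonneg (by nlinarith) hL'.le)
    (by rw [div_le_iff₀ hL']; linarith)
  have h' := mul_le_mul_of_nonneg_left h (pow_pos hL' 3).le
  have e1 : (L' / L) ^ 3 * (d 0 * d 1 * d 2) = L' ^ 3 * (d 0 / L * (d 1 / L) * (d 2 / L)) := by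
    field_simp
  have e2 : ∀ i, L' + ν * (d i - L) = L' * (1 - -(ν * L) / L' * (d i / L - 1)) := fun i => by
    field_simp; ring
  rw [e1, e2, e2, e2]
  refine h'.trans (le_of_eq ?_)
  ring

-- Both matrices are diagonal in the same orthonormal basis. Each eigenvalue of `S` is at most the
-- trace $3L$, so for $\nu\le0$ the new eigenvalues are at least $L'+2\nu L>0$.
open Matrix in
theorem posDef_and_det_le {S : Matrix (Fin 3) (Fin 3) ℝ} (hS : S.PosDef) {L L' ν : ℝ}
    (hL : 0 < L) (hs : S.trace = 3 * L) (hν : ν ≤ 0) (hν' : 0 < L' + 2 * (ν * L)) :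
    (L' • (1 : Matrix (Fin 3) (Fin 3) ℝ) + ν • (S - L • (1 : Matrix (Fin 3) (Fin 3) ℝ))).PosDef ∧
    (L' / L) ^ 3 * S.det
      ≤ (L' • (1 : Matrix (Fin 3) (Fin 3) ℝ) + ν • (S - L • (1 : Matrix (Fin 3) (Fin 3) ℝ))).det := by
  obtain ⟨U, d, hU, hU', rfl⟩ := exists_orthogonal_diagonalization hS.isHermitian
  have hd := (posDef_conj_diagonal_iff hU d).mp hS
  have e : L' • (1 : Matrix (Fin 3) (Fin 3) ℝ)
      + ν • (U * diagonal d * Uᵀ - L • (1 : Matrix (Fin 3) (Fin 3) ℝ))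
      = U * diagonal (fun i => L' + ν * (d i - L)) * Uᵀ := by
    have : diagonal (fun i => L' + ν * (d i - L))
        = L' • (1 : Matrix (Fin 3) (Fin 3) ℝ) + ν • (diagonal d - L • 1) := by
      ext i j
      by_cases h : i = j
      · subst h; simp
      · simp [h, Matrix.one_apply_ne h]
    rw [this]
    simp only [Matrix.mul_add, Matrix.add_mul, Matrix.mul_sub, Matrix.sub_mul, Matrix.mul_smul,
      Matrix.smul_mul, Matrix.mul_one, hU]
  have hdet : ∀ c : Fin 3 → ℝ, (U * diagonal c * Uᵀ).det = ∏ i, c i := fun c => by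
    rw [det_mul, det_mul, mul_comm, ← mul_assoc, ← det_mul, hU', det_one, one_mul, det_diagonal]
  rw [trace_mul_comm, ← Matrix.mul_assoc, hU', Matrix.one_mul, trace_diagonal] at hs
  have hL' : 0 < L' := by nlinarith
  rw [e, posDef_conj_diagonal_iff hU, hdet, hdet]
  refine ⟨fun i => ?_, prod_le_prod_add_mul_sub hd hL hs hL' hν hν'.le⟩
  have : d i ≤ 3 * L := hs ▸ Finset.single_le_sum (fun j _ => (hd j).le) (Finset.mem_univ i)
  nlinarith

/-! ### The isotropic relaxation inequality -/

/-- This is $x\le\sinh x$ at $x=u/2$. -/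
theorem mul_exp_half_le {u : ℝ} (hu : 0 ≤ u) : u * exp (u / 2) ≤ exp u - 1 := by
  have h : u / 2 ≤ sinh (u / 2) := self_le_sinh_iff.mpr (by linarith)
  rw [sinh_eq] at h
  have h2 := mul_le_mul_of_nonneg_right h (exp_pos (u / 2)).le
  have e1 : exp (u / 2) * exp (u / 2) = exp u := by rw [← exp_add]; ring_nf
  have e2 : exp (-(u / 2)) * exp (u / 2) = 1 := by rw [← exp_add]; simp
  nlinarith

/-- With $u=T_0/T$ the function is $(RT-e_{vib}(T))/(RT_0)$, so the claim is $c_v^{vib}\le R$. The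
sign of the derivative is the square of `mul_exp_half_le`. -/
theorem antitoneOn_inv_sub_inv_exp_sub_one :
    AntitoneOn (fun u : ℝ => u⁻¹ - (exp u - 1)⁻¹) (Set.Ioi 0) := by
  have hd : ∀ u : ℝ, 0 < u → HasDerivAt (fun u : ℝ => u⁻¹ - (exp u - 1)⁻¹)
      (-(u ^ 2)⁻¹ - -exp u / (exp u - 1) ^ 2) u := fun u hu =>
    (hasDerivAt_inv hu.ne').sub
      (((hasDerivAt_exp u).sub_const 1).inv (by have := one_lt_exp_iff.mpr hu; linarith))
  refine antitoneOn_of_deriv_nonpos (convex_Ioi 0)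
    (fun u hu => (hd u hu).continuousAt.continuousWithinAt) ?_ ?_
  · rw [interior_Ioi]
    exact fun u hu => (hd u hu).differentiableAt.differentiableWithinAt
  · rw [interior_Ioi]
    intro u hu
    have hu : 0 < u := hu
    rw [(hd u hu).deriv]
    have h1 : 0 < exp u - 1 := by have := one_lt_exp_iff.mpr hu; linarith
    have h2 := pow_le_pow_left₀ (by positivity) (mul_exp_half_le hu.le) 2
    have e1 : exp (u / 2) ^ 2 = exp u := by rw [← exp_nat_mul]; congr 1; push_cast; ring
    rw [mul_pow, e1] at h2
    have : exp u / (exp u - 1) ^ 2 ≤ (u ^ 2)⁻¹ := by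
      rw [inv_eq_one_div, div_le_div_iff₀ (by positivity) (by positivity)]
      linarith
    rw [neg_div]
    linarith

/-- The specific vibrational entropy as a function of the vibrational energy. -/
noncomputable def vibEntropy (a e : ℝ) : ℝ :=
  -(log a - log (a + e) + e / a * (log e - log (a + e)))

/-- The inverse vibrational temperature `1 / (R T)`, the slope of `vibEntropy`. -/
noncomputable def vibSlope (a e : ℝ) : ℝ := (log (a + e) - log e) / a

/-- The tangent inequality of a concave function, obtained from the vibrational Bregman distance at
$F=F_0=1$. -/
theorem vibEntropy_le {a e e' : ℝ} (ha : 0 < a) (he : 0 < e) (he' : 0 < e') :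
    vibEntropy a e ≤ vibEntropy a e' + vibSlope a e' * (e - e') := by
  have h := vib_bregman_nonneg ha one_pos he one_pos he'
  simp only [mul_one, one_mul] at h
  simp only [vibEntropy, vibSlope]
  have : (log (a + e') - log e') / a * (e - e')
      = e / a * (log (a + e') - log e') - e' / a * (log (a + e') - log e') := by ring
  rw [this]
  nlinarith

theorem log_le_add {x y : ℝ} (hx : 0 < x) (hy : 0 < y) : log x ≤ log y + (x - y) / y := by
  have := log_le_sub_one_of_pos (div_pos hx hy)
  rw [log_div hx.ne' hy.ne'] at this
  rw [sub_div, div_self hy.ne']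
  linarith

theorem vibSlope_pos {a e : ℝ} (ha : 0 < a) (he : 0 < e) : 0 < vibSlope a e :=
  div_pos (sub_pos.mpr (log_lt_log he (by linarith))) ha

theorem exp_mul_vibSlope {a e : ℝ} (ha : 0 < a) (he : 0 < e) :
    exp (a * vibSlope a e) - 1 = a / e := by
  rw [vibSlope, mul_div_cancel₀ _ ha.ne', exp_sub, exp_log (by positivity), exp_log he]
  field_simp
  ring

/-- The substitution $u=a\cdot$`vibSlope` turns `e` into $a/(e^u-1)$ and reverses the order, which
reduces the claim to the preceding antitone function. -/
theorem monotoneOn_inv_vibSlope_sub {a : ℝ} (ha : 0 < a) :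
    MonotoneOn (fun e => (vibSlope a e)⁻¹ - e) (Set.Ioi 0) := by
  intro e he e' he' hee
  have he : 0 < e := he
  have he' : 0 < e' := he'
  have h1 : a * vibSlope a e' ≤ a * vibSlope a e := by
    rw [← exp_le_exp, ← sub_le_sub_iff_right 1, exp_mul_vibSlope ha he, exp_mul_vibSlope ha he']
    gcongr
  have h2 := antitoneOn_inv_sub_inv_exp_sub_one (mul_pos ha (vibSlope_pos ha he'))
    (mul_pos ha (vibSlope_pos ha he)) h1
  simp only [exp_mul_vibSlope ha he, exp_mul_vibSlope ha he', inv_div, mul_inv] at h2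
  have h3 := mul_le_mul_of_nonneg_left h2 ha.le
  have e3 : ∀ s x : ℝ, a * (a⁻¹ * s - x / a) = s - x := fun s x => by field_simp
  rwa [e3, e3] at h3

theorem vibSlope_exp {a L : ℝ} (ha : 0 < a) (hL : 0 < L) :
    vibSlope a (a / (exp (a / L) - 1)) = L⁻¹ := by
  have h1 : 0 < exp (a / L) - 1 := by
    have := one_lt_exp_iff.mpr (div_pos ha hL); linarith
  have : a + a / (exp (a / L) - 1) = a / (exp (a / L) - 1) * exp (a / L) := by
    field_simp; ring
  rw [vibSlope, this, log_mul (by positivity) (exp_pos _).ne', log_exp]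
  field_simp
  ring

/-- This is $e_{vib}(T)<RT$ with $L=RT$; it keeps the translational energy positive after
relaxation. -/
theorem div_exp_sub_one_lt {a L : ℝ} (ha : 0 < a) (hL : 0 < L) :
    a / (exp (a / L) - 1) < L := by
  have h := add_one_lt_exp (div_pos ha hL).ne'
  have h0 := div_pos ha hL
  rw [div_lt_iff₀ (by linarith)]
  have : L * (a / L) = a := by field_simp
  nlinarith

/-- Relaxation between translation and vibration alone does not decrease the entropy. -/
theorem entropy_le_relax_vib {a L e D : ℝ} (ha : 0 < a) (hL : 0 < L) (he : 0 < e)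
    (hD : D = a / (exp (a / L) - 1) - e) :
    3 / 2 * log L + vibEntropy a e
      ≤ 3 / 2 * log (L - 2 / 5 * D) + vibEntropy a (e + 3 / 5 * D) := by
  have hlt := div_exp_sub_one_lt ha hL
  have hs : 0 < a / (exp (a / L) - 1) :=
    div_pos ha (by have := one_lt_exp_iff.mpr (div_pos ha hL); linarith)
  have hslope := vibSlope_exp ha hL
  generalize a / (exp (a / L) - 1) = es at *
  have hL' : 0 < L - 2 / 5 * D := by linarith
  have he' : 0 < e + 3 / 5 * D := by linarith
  have h1 := log_le_add hL hL'
  have h2 := vibEntropy_le ha he he'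
  -- Relaxation with ratio $3/5$ does not overshoot. Put $e_s=e+D$ and $e'=e+\frac35D$. If $D\ge0$,
  -- monotonicity of $1/$`vibSlope`$-e$ between $e'$ and $e_s$ gives $1/$`vibSlope`$(e')\le
  -- L-e_s+e'=L-\frac25D$; for $D\le0$ the inequality is reversed. The ratio $3/5$ is the one with
  -- $\frac23\beta=1-\beta$.
  have key : 0 ≤ D * (vibSlope a (e + 3 / 5 * D) - (L - 2 / 5 * D)⁻¹) := by
    have hp := vibSlope_pos ha he'
    rcases le_total 0 D with h | h
    · refine mul_nonneg h (sub_nonneg.mpr ?_)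
      have := monotoneOn_inv_vibSlope_sub ha he' (Set.mem_Ioi.mpr hs) (by linarith)
      simp only [hslope, inv_inv] at this
      rw [inv_le_comm₀ hL' hp]
      linarith
    · refine mul_nonneg_of_nonpos_of_nonpos h (sub_nonpos.mpr ?_)
      have := monotoneOn_inv_vibSlope_sub ha (Set.mem_Ioi.mpr hs) he' (by linarith)
      simp only [hslope, inv_inv] at this
      rw [le_inv_comm₀ hp hL']
      linarith
  have e1 : (L - (L - 2 / 5 * D)) / (L - 2 / 5 * D) = 2 / 5 * (D * (L - 2 / 5 * D)⁻¹) := by ring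
  rw [e1] at h1
  nlinarith

/-- Relaxation between translation and rotation alone does not decrease the entropy. -/
theorem entropy_le_relax_rot {L r : ℝ} (hL : 0 < L) (hr : 0 < r) :
    3 / 2 * log L + log r
      ≤ 3 / 2 * log (L - 2 / 5 * (L - r)) + log (r + 3 / 5 * (L - r)) := by
  -- With ratio $3/5$ both modes reach the common value $\frac35L+\frac25r$, and the tangent terms
  -- of the two logarithms cancel there.
  have e : r + 3 / 5 * (L - r) = L - 2 / 5 * (L - r) := by ring
  have hp : 0 < L - 2 / 5 * (L - r) := by nlinarith
  have h1 := log_le_add hL hp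
  have h2 := log_le_add hr hp
  rw [e]
  have e1 : 3 / 2 * ((L - (L - 2 / 5 * (L - r))) / (L - 2 / 5 * (L - r)))
      + (r - (L - 2 / 5 * (L - r))) / (L - 2 / 5 * (L - r)) = 0 := by
    field_simp; ring
  linarith

/-- Relaxation of the energies does not decrease the entropy of isotropic states. -/
theorem entropy_le_relax {a L r e D α β : ℝ} (ha : 0 < a) (hL : 0 < L) (hr : 0 < r) (he : 0 < e)
    (hD : D = a / (exp (a / L) - 1) - e) (hα : 0 ≤ α) (hβ : 0 ≤ β) (hαβ : α + β ≤ 3 / 5) :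
    3 / 2 * log L + log r + vibEntropy a e
      ≤ 3 / 2 * log (L - 2 / 3 * (α * (L - r) + β * D)) + log (r + α * (L - r))
        + vibEntropy a (e + β * D) := by
  have hv := entropy_le_relax_vib ha hL he hD
  have hR := entropy_le_relax_rot hL hr
  have hlt := div_exp_sub_one_lt ha hL
  have hs : 0 < a / (exp (a / L) - 1) :=
    div_pos ha (by have := one_lt_exp_iff.mpr (div_pos ha hL); linarith)
  generalize a / (exp (a / L) - 1) = es at *
  have p1 : 0 < L - 2 / 5 * (L - r) := by linarith
  have p2 : 0 < L - 2 / 5 * D := by linarith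
  have p3 : 0 < r + 3 / 5 * (L - r) := by linarith
  have p4 : 0 < e + 3 / 5 * D := by linarith
  -- The relaxed state is the convex combination, with weights $1-s-t$, $s$, $t$, of the initial
  -- state, the one with only rotation relaxed and the one with only vibration relaxed. Concavity is
  -- applied through tangents at the relaxed state; `z1`, `z2`, `z3` say that the tangent terms
  -- cancel.
  obtain ⟨s, rfl⟩ : ∃ s, α = 3 / 5 * s := ⟨5 / 3 * α, by ring⟩
  obtain ⟨t, rfl⟩ : ∃ t, β = 3 / 5 * t := ⟨5 / 3 * β, by ring⟩
  have hs0 : 0 ≤ s := by linarith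
  have ht0 : 0 ≤ t := by linarith
  have hst : 0 ≤ 1 - s - t := by linarith
  have q1 : 0 < L - 2 / 3 * (3 / 5 * s * (L - r) + 3 / 5 * t * D) := by
    have e0 : L - 2 / 3 * (3 / 5 * s * (L - r) + 3 / 5 * t * D)
      = (1 - s - t) * (2 / 5 * L) + 3 / 5 * L + s * (2 / 5 * r) + t * (2 / 5 * (L - D)) := by ring
    have : 0 ≤ L - D := by linarith
    rw [e0]; positivity
  have q2 : 0 < r + 3 / 5 * s * (L - r) := by
    have e0 : r + 3 / 5 * s * (L - r) = 2 / 5 * r + 3 / 5 * ((1 - s - t + t) * r) + s * (3 / 5 * L) := by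
      ring
    rw [e0]; positivity
  have q3 : 0 < e + 3 / 5 * t * D := by
    have e0 : e + 3 / 5 * t * D = 2 / 5 * e + 3 / 5 * ((1 - s - t + s) * e) + t * (3 / 5 * es) := by
      rw [hD]; ring
    rw [e0]; positivity
  have a0 := mul_le_mul_of_nonneg_left (log_le_add hL q1) hst
  have a1 := mul_le_mul_of_nonneg_left (log_le_add p1 q1) hs0
  have a2 := mul_le_mul_of_nonneg_left (log_le_add p2 q1) ht0
  have b0 := mul_le_mul_of_nonneg_left (log_le_add hr q2) (show 0 ≤ 1 - s by linarith)
  have b1 := mul_le_mul_of_nonneg_left (log_le_add p3 q2) hs0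
  have c0 := mul_le_mul_of_nonneg_left (vibEntropy_le ha he q3) (show 0 ≤ 1 - t by linarith)
  have c1 := mul_le_mul_of_nonneg_left (vibEntropy_le ha p4 q3) ht0
  have d1 := mul_le_mul_of_nonneg_left hR hs0
  have d2 := mul_le_mul_of_nonneg_left hv ht0
  generalize hp : L - 2 / 3 * (3 / 5 * s * (L - r) + 3 / 5 * t * D) = p at *
  generalize hq : r + 3 / 5 * s * (L - r) = q at *
  generalize hw : e + 3 / 5 * t * D = w at *
  have z1 : (1 - s - t) * ((L - p) / p) + s * ((L - 2 / 5 * (L - r) - p) / p)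
      + t * ((L - 2 / 5 * D - p) / p) = 0 := by
    rw [← hp]; field_simp; ring
  have z2 : (1 - s) * ((r - q) / q) + s * ((r + 3 / 5 * (L - r) - q) / q) = 0 := by
    rw [← hq]; field_simp; ring
  have z3 : (1 - t) * (vibSlope a w * (e - w)) + t * (vibSlope a w * (e + 3 / 5 * D - w)) = 0 := by
    rw [← hw]; ring
  simp only [mul_add] at *
  linarith

/-! ### Energies and temperatures -/

namespace Model

variable (P : Model)

theorem eVib_eq {T : ℝ} : P.eVib T = P.vibScale / (exp (P.vibScale / (P.R * T)) - 1) := by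
  rw [eVib, vibScale, mul_div_mul_left _ _ P.R_pos.ne']

theorem eVib_pos {T : ℝ} (hT : 0 < T) : 0 < P.eVib T :=
  div_pos (mul_pos P.R_pos P.T₀_pos) (by have := one_lt_exp_iff.mpr (div_pos P.T₀_pos hT); linarith)

theorem hasDerivAt_eVib {T : ℝ} (hT : 0 < T) :
    HasDerivAt P.eVib (P.R * (P.T₀ / T) ^ 2 * exp (P.T₀ / T) / (exp (P.T₀ / T) - 1) ^ 2) T := by
  have hx : exp (P.T₀ / T) - 1 ≠ 0 := by have := one_lt_exp_iff.mpr (div_pos P.T₀_pos hT); linarith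
  have h1 : HasDerivAt (fun T => P.T₀ / T) (P.T₀ * -(T ^ 2)⁻¹) T := by
    simpa [div_eq_mul_inv] using (hasDerivAt_inv hT.ne').const_mul P.T₀
  have := ((h1.exp.sub_const 1).inv hx).const_mul (P.R * P.T₀)
  refine this.congr_deriv ?_
  field_simp

/-- With $y=T_0/T$ this is $e^y-1\le ye^y$. It lets the bound on $\kappa$, stated with specific
heats, control the energy $e_{vib}(T_{tr})$. -/
theorem eVib_le_mul_cvVib {T : ℝ} (hT : 0 < T) : P.eVib T ≤ T * P.cvVib T := by
  rw [cvVib, (P.hasDerivAt_eVib hT).deriv, eVib]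
  have hR := P.R_pos
  have hT₀ := P.T₀_pos
  have hy : 0 < P.T₀ / T := div_pos hT₀ hT
  have h1 := one_lt_exp_iff.mpr hy
  have h0 : 0 < exp (P.T₀ / T) - 1 := by linarith
  have h2 := add_one_le_exp (-(P.T₀ / T))
  have h3 : exp (-(P.T₀ / T)) * exp (P.T₀ / T) = 1 := by rw [← exp_add]; simp
  have h4 : exp (P.T₀ / T) - 1 ≤ P.T₀ / T * exp (P.T₀ / T) := by nlinarith
  have e : T * (P.R * (P.T₀ / T) ^ 2 * exp (P.T₀ / T) / (exp (P.T₀ / T) - 1) ^ 2)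
      = P.R * P.T₀ * (P.T₀ / T * exp (P.T₀ / T)) / (exp (P.T₀ / T) - 1) ^ 2 := by
    field_simp
  rw [e, div_le_div_iff₀ h0 (by positivity)]
  nlinarith [mul_le_mul_of_nonneg_left h4 (by positivity : 0 ≤ P.R * P.T₀ * (exp (P.T₀ / T) - 1))]

theorem strictMonoOn_eVib : StrictMonoOn P.eVib (Set.Ioi 0) := by
  intro T hT T' hT' h
  have hT : 0 < T := hT
  have hT' : 0 < T' := hT'
  have hT₀ := P.T₀_pos
  have h1 := one_lt_exp_iff.mpr (div_pos P.T₀_pos hT')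
  have h2 : exp (P.T₀ / T') < exp (P.T₀ / T) := exp_lt_exp.mpr (by gcongr)
  exact div_lt_div_of_pos_left (mul_pos P.R_pos hT₀) (by linarith) (by linarith)

theorem injOn_eTot : Set.InjOn P.eTot (Set.Ioi 0) := by
  refine StrictMonoOn.injOn fun T hT T' hT' h => ?_
  have := P.strictMonoOn_eVib hT hT' h
  have hR := mul_lt_mul_of_pos_left h P.R_pos
  simp only [eTot, eTr, eRot, δ]
  nlinarith

theorem eTotInv_eTot {T : ℝ} (hT : 0 < T) : P.eTotInv (P.eTot T) = T :=
  P.injOn_eTot.leftInvOn_invFunOn hT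

theorem eVib_eVibInv {E : ℝ} (hE : 0 < E) : P.eVib (P.eVibInv E) = E := by
  have hR := P.R_pos
  have hT₀ := P.T₀_pos
  rw [eVib, eVibInv, div_div_cancel₀ hT₀.ne', exp_log (by positivity)]
  field_simp
  ring

theorem cvTr_eq (T : ℝ) : P.cvTr T = 3 / 2 * P.R := by
  exact ((hasDerivAt_id T).const_mul (3 / 2 * P.R)).deriv.trans (mul_one _)

theorem cvRot_eq (T : ℝ) : P.cvRot T = P.R := by
  exact ((hasDerivAt_id T).const_mul (δ / 2 * P.R)).deriv.trans (by norm_num [δ])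

end Model
end ESBGK

namespace ESBGK

/-! ### Moments of triples -/

/-- The triple `W` has mass `ρ`, covariance `S` about `u`, and specific internal energies
`er`, `ev`. -/
structure HasMoments (W : V → ℝ × ℝ × ℝ) (ρ : ℝ) (u : V) (S : Matrix (Fin 3) (Fin 3) ℝ)
    (er ev : ℝ) : Prop where
  F_int : Integrable fun v => (W v).1
  F_eq : ∫ v, (W v).1 = ρ
  S_int : ∀ i j, Integrable fun v : V => (v i - u i) * (v j - u j) * (W v).1
  S_eq : ∀ i j, ∫ v : V, (v i - u i) * (v j - u j) * (W v).1 = ρ * S i j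
  G_int : Integrable fun v => (W v).2.1
  G_eq : ∫ v, (W v).2.1 = ρ * er
  H_int : Integrable fun v => (W v).2.2
  H_eq : ∫ v, (W v).2.2 = ρ * ev

theorem HasMoments.congr {W W' : V → ℝ × ℝ × ℝ} {ρ : ℝ} {u : V} {S : Matrix (Fin 3) (Fin 3) ℝ}
    {er ev : ℝ} (h : HasMoments W ρ u S er ev) (hW : W =ᵐ[volume] W') :
    HasMoments W' ρ u S er ev := by
  have h1 : (fun v => (W v).1) =ᵐ[volume] fun v => (W' v).1 := hW.fun_comp Prod.fst
  have h2 : (fun v => (W v).2.1) =ᵐ[volume] fun v => (W' v).2.1 := hW.fun_comp fun p => p.2.1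
  have h3 : (fun v => (W v).2.2) =ᵐ[volume] fun v => (W' v).2.2 := hW.fun_comp fun p => p.2.2
  have h4 : ∀ i j, (fun v : V => (v i - u i) * (v j - u j) * (W v).1)
      =ᵐ[volume] fun v : V => (v i - u i) * (v j - u j) * (W' v).1 := fun i j => by
    filter_upwards [h1] with v hv using by rw [hv]
  exact ⟨h.F_int.congr h1, integral_congr_ae h1 ▸ h.F_eq, fun i j => (h.S_int i j).congr (h4 i j),
    fun i j => integral_congr_ae (h4 i j) ▸ h.S_eq i j, h.G_int.congr h2,
    integral_congr_ae h2 ▸ h.G_eq, h.H_int.congr h3, integral_congr_ae h3 ▸ h.H_eq⟩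

theorem HasMoments.unique {W : V → ℝ × ℝ × ℝ} {ρ : ℝ} {u : V} {S S' : Matrix (Fin 3) (Fin 3) ℝ}
    {er ev er' ev' : ℝ} (hρ : ρ ≠ 0) (h : HasMoments W ρ u S er ev)
    (h' : HasMoments W ρ u S' er' ev') : S = S' ∧ er = er' ∧ ev = ev' :=
  ⟨Matrix.ext fun i j => mul_left_cancel₀ hρ ((h.S_eq i j).symm.trans (h'.S_eq i j)),
    mul_left_cancel₀ hρ (h.G_eq.symm.trans h'.G_eq),
    mul_left_cancel₀ hρ (h.H_eq.symm.trans h'.H_eq)⟩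

/-- The triple `(M, er M, ev M)` with `M` the Gaussian of mass `ρ`, mean `u`, covariance `S`. -/
noncomputable def gaussState (ρ : ℝ) (u : V) (S : Matrix (Fin 3) (Fin 3) ℝ) (er ev : ℝ) (v : V) :
    ℝ × ℝ × ℝ :=
  (ρ * gaussianDensity S (v - u).ofLp, er * (ρ * gaussianDensity S (v - u).ofLp),
    ev * (ρ * gaussianDensity S (v - u).ofLp))

theorem integral_comp_sub_ofLp (φ : (Fin 3 → ℝ) → ℝ) (u : V) :
    ∫ v : V, φ (v - u).ofLp = ∫ x, φ x := by
  rw [integral_sub_right_eq_self (fun v : V => φ v.ofLp) u]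
  exact (PiLp.volume_preserving_ofLp (Fin 3)).integral_comp
    (MeasurableEquiv.toLp 2 (Fin 3 → ℝ)).symm.measurableEmbedding φ

theorem integrable_comp_sub_ofLp {φ : (Fin 3 → ℝ) → ℝ} (hφ : Integrable φ) (u : V) :
    Integrable fun v : V => φ (v - u).ofLp := by
  have : Integrable fun v : V => φ v.ofLp :=
    ((PiLp.volume_preserving_ofLp (Fin 3)).integrable_comp_emb
      (MeasurableEquiv.toLp 2 (Fin 3 → ℝ)).symm.measurableEmbedding).mpr hφ
  exact this.comp_sub_right u

theorem hasMoments_gaussState (ρ : ℝ) (u : V) {S : Matrix (Fin 3) (Fin 3) ℝ} (hS : S.PosDef)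
    (er ev : ℝ) : HasMoments (gaussState ρ u S er ev) ρ u S er ev := by
  have i1 := integrable_comp_sub_ofLp (integrable_gaussianDensity hS) u
  have e1 := integral_comp_sub_ofLp (gaussianDensity S) u
  rw [integral_gaussianDensity hS] at e1
  have i2 := fun i j => integrable_comp_sub_ofLp (integrable_mul_gaussianDensity hS i j) u
  have e2 := fun i j => integral_comp_sub_ofLp (fun x => x i * x j * gaussianDensity S x) u
  simp only [integral_mul_gaussianDensity hS] at e2
  have i1' := i1.const_mul ρ
  have e : ∀ i j, (fun v : V => (v i - u i) * (v j - u j) * (gaussState ρ u S er ev v).1)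
      = fun v => ρ * ((v - u).ofLp i * (v - u).ofLp j * gaussianDensity S (v - u).ofLp) :=
    fun i j => by
      funext v
      simp only [gaussState, PiLp.sub_apply]
      ring
  have e1' : ∫ v : V, ρ * gaussianDensity S (v - u).ofLp = ρ := by
    rw [integral_const_mul, e1, mul_one]
  refine ⟨i1', e1', fun i j => ?_, fun i j => ?_, i1'.const_mul er, ?_, i1'.const_mul ev, ?_⟩
  · rw [e]; exact (i2 i j).const_mul ρ
  · rw [e, integral_const_mul, e2]
  · exact (integral_const_mul _ _).trans (by rw [e1', mul_comm])
  · exact (integral_const_mul _ _).trans (by rw [e1', mul_comm])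

theorem gaussState_mem_octant {ρ : ℝ} (hρ : 0 < ρ) (u : V) {S : Matrix (Fin 3) (Fin 3) ℝ}
    (hS : S.PosDef) {er ev : ℝ} (her : 0 < er) (hev : 0 < ev) (v : V) :
    gaussState ρ u S er ev v ∈ octant := by
  have := gaussianDensity_pos hS (v - u).ofLp
  exact ⟨mul_pos hρ this, mul_pos her (mul_pos hρ this), mul_pos hev (mul_pos hρ this)⟩

/-- The negative specific entropy of a Gaussian state, up to a constant. -/
noncomputable def gaussEntropy (a : ℝ) (S : Matrix (Fin 3) (Fin 3) ℝ) (er ev : ℝ) : ℝ :=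
  -(1 / 2 * log S.det + log er + vibEntropy a ev)

namespace Model

variable (P : Model)

/-- The differential of the entropy density at a Gaussian state is a quadratic polynomial. -/
theorem fderiv_h_gaussState {ρ : ℝ} (hρ : 0 < ρ) (u : V) {S : Matrix (Fin 3) (Fin 3) ℝ}
    (hS : S.PosDef) {er ev : ℝ} (her : 0 < er) (hev : 0 < ev) (v : V) (w : ℝ × ℝ × ℝ) :
    fderiv ℝ P.h (gaussState ρ u S er ev v) w =
      (log ρ - log √(((2 * π) • S).det) + 2 - log er + log P.vibScale - log (P.vibScale + ev)) * w.1
      - 1 / 2 * ∑ i, ∑ j, S⁻¹ i j * ((v i - u i) * (v j - u j) * w.1)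
      - 1 / er * w.2.1 + (log ev - log (P.vibScale + ev)) / P.vibScale * w.2.2 := by
  rw [P.fderiv_h (gaussState_mem_octant hρ u hS her hev v)]
  have ha := P.vibScale_pos
  have hg := gaussianDensity_pos hS (v - u).ofLp
  have hM := mul_pos hρ hg
  have hd := (hS.smul (show (0 : ℝ) < 2 * π by positivity)).det_pos
  have hlog : log (ρ * gaussianDensity S (v - u).ofLp) = log ρ - log √(((2 * π) • S).det)
      - 1 / 2 * ∑ i, ∑ j, S⁻¹ i j * ((v i - u i) * (v j - u j)) := by
    rw [log_mul hρ.ne' hg.ne', gaussianDensity, log_mul (by positivity) (exp_pos _).ne', log_exp,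
      one_div, log_inv]
    have : (v - u).ofLp ⬝ᵥ S⁻¹.mulVec (v - u).ofLp
        = ∑ i, ∑ j, S⁻¹ i j * ((v i - u i) * (v j - u j)) := by
      simp only [dotProduct, Matrix.mulVec, Finset.mul_sum, PiLp.sub_apply]
      exact Finset.sum_congr rfl fun i _ => Finset.sum_congr rfl fun j _ => by ring
    rw [this]
    ring
  have e1 : ∑ i, ∑ j, S⁻¹ i j * ((v i - u i) * (v j - u j) * w.1)
      = (∑ i, ∑ j, S⁻¹ i j * ((v i - u i) * (v j - u j))) * w.1 := by
    simp only [Finset.sum_mul, mul_assoc]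
  simp only [hF, hH, gaussState]
  rw [e1]
  generalize (∑ i, ∑ j, S⁻¹ i j * ((v i - u i) * (v j - u j))) = q at *
  generalize ρ * gaussianDensity S (v - u).ofLp = M at *
  rw [← add_mul, log_mul her.ne' hM.ne', log_mul ha.ne' hM.ne', log_mul (by positivity) hM.ne',
    log_mul hev.ne' hM.ne', hlog]
  have : M / (er * M) = 1 / er := by field_simp
  rw [this]
  ring

theorem sum_inv_mul {S : Matrix (Fin 3) (Fin 3) ℝ} (hS : S.PosDef) :
    ∑ i, ∑ j, S⁻¹ i j * S i j = 3 := by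
  have h : (S⁻¹ * S).trace = 3 := by
    rw [Matrix.nonsing_inv_mul _ hS.det_pos.ne'.isUnit]
    simp
  rw [← h, Matrix.trace]
  refine Finset.sum_congr rfl fun i _ => ?_
  rw [Matrix.diag_apply, Matrix.mul_apply]
  refine Finset.sum_congr rfl fun j _ => ?_
  have := hS.isHermitian.apply i j
  simp only [star_trivial] at this
  rw [this]

theorem integral_sub_sub_add {f₁ f₂ f₃ f₄ : V → ℝ} (h₁ : Integrable f₁) (h₂ : Integrable f₂)
    (h₃ : Integrable f₃) (h₄ : Integrable f₄) :
    ∫ v, f₁ v - f₂ v - f₃ v + f₄ v = (∫ v, f₁ v) - (∫ v, f₂ v) - (∫ v, f₃ v) + ∫ v, f₄ v := by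
  have h12 : Integrable fun v => f₁ v - f₂ v := h₁.sub h₂
  have h123 : Integrable fun v => f₁ v - f₂ v - f₃ v := h12.sub h₃
  rw [integral_add h123 h₄, integral_sub h12 h₃, integral_sub h₁ h₂]

/-- The differential involves $v$ only through the centred products $(v_i-u_i)(v_j-u_j)$, so the
integral depends only on the quantities in `HasMoments`; no first moment is needed. The quadratic
term contributes $S^{-1}:S=3$. -/
theorem integral_fderiv_h_gaussState {ρ : ℝ} (hρ : 0 < ρ) {u : V} {S : Matrix (Fin 3) (Fin 3) ℝ}
    (hS : S.PosDef) {er ev : ℝ} (her : 0 < er) (hev : 0 < ev) {W : V → ℝ × ℝ × ℝ}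
    (hW : HasMoments W ρ u S er ev) :
    Integrable (fun v => fderiv ℝ P.h (gaussState ρ u S er ev v) (W v)) ∧
    ∫ v, fderiv ℝ P.h (gaussState ρ u S er ev v) (W v)
      = ρ * (log ρ - 3 / 2 * log (2 * π) - 1 / 2 + gaussEntropy P.vibScale S er ev) := by
  simp_rw [P.fderiv_h_gaussState hρ u hS her hev]
  have ha := P.vibScale_pos
  have j2 := fun i j => (hW.S_int i j).const_mul (S⁻¹ i j)
  have i1 := hW.F_int.const_mul (log ρ - log √(((2 * π) • S).det) + 2 - log er + log P.vibScale
    - log (P.vibScale + ev))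
  have i2 : Integrable fun v : V =>
      1 / 2 * ∑ i, ∑ j, S⁻¹ i j * ((v i - u i) * (v j - u j) * (W v).1) :=
    (integrable_finsetSum _ fun i _ => integrable_finsetSum _ fun j _ => j2 i j).const_mul _
  have i3 := hW.G_int.const_mul (1 / er)
  have i4 := hW.H_int.const_mul ((log ev - log (P.vibScale + ev)) / P.vibScale)
  refine ⟨((i1.sub i2).sub i3).add i4, (integral_sub_sub_add i1 i2 i3 i4).trans ?_⟩
  rw [integral_const_mul, integral_const_mul, integral_const_mul, integral_const_mul, hW.F_eq,
    hW.G_eq, hW.H_eq,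
    integral_finsetSum _ fun i _ => integrable_finsetSum _ fun j _ => j2 i j]
  simp_rw [integral_finsetSum _ fun j _ => j2 _ j, integral_const_mul, hW.S_eq]
  have e1 : ∑ i, ∑ j, S⁻¹ i j * (ρ * S i j) = 3 * ρ := by
    rw [← sum_inv_mul hS]
    simp only [Finset.sum_mul]
    exact Finset.sum_congr rfl fun i _ => Finset.sum_congr rfl fun j _ => by ring
  have e2 : log √(((2 * π) • S).det) = 3 / 2 * log (2 * π) + 1 / 2 * log S.det := by
    rw [log_sqrt (hS.smul (show (0 : ℝ) < 2 * π by positivity)).det_pos.le, Matrix.det_smul,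
      log_mul (by positivity) hS.det_pos.ne', log_pow]
    simp
    ring
  rw [e1, e2, gaussEntropy, vibEntropy]
  field_simp
  ring

/-- Differentiate $h(\lambda p)=\lambda h(p)+\lambda\log\lambda\,p_1$ at $\lambda=1$. -/
theorem fderiv_h_self {p : ℝ × ℝ × ℝ} (hp : p ∈ octant) :
    fderiv ℝ P.h p p = P.h p + p.1 := by
  rw [P.fderiv_h hp, P.h_eq hp]
  have ha := P.vibScale_pos
  obtain ⟨h1, h2, h3⟩ := hp
  simp only [hF, hH]
  field_simp
  ring

end Model

/-! ### Moments of states -/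

section State

variable {W : V → ℝ × ℝ × ℝ}

theorem IsState.integrable_mul (hs : IsState W) {φ : V → ℝ} (hφ : Continuous φ) {C : ℝ}
    (hC : ∀ v, |φ v| ≤ C * (1 + ‖v‖ ^ 2)) : Integrable fun v => φ v * (W v).1 := by
  have h1 : Continuous fun v : V => φ v / (1 + ‖v‖ ^ 2) :=
    hφ.div (by fun_prop) fun v => by positivity
  refine (hs.F_int.bdd_mul (c := C) h1.aestronglyMeasurable (ae_of_all _ fun v => ?_)).congr
    (ae_of_all _ fun v => ?_)
  · have : 0 < 1 + ‖v‖ ^ 2 := by positivity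
    rw [norm_eq_abs, abs_div, abs_of_pos this, div_le_iff₀ this]
    exact hC v
  · have : 1 + ‖v‖ ^ 2 ≠ 0 := by positivity
    field_simp

theorem IsState.integrable_F (hs : IsState W) : Integrable fun v => (W v).1 := by
  simpa using hs.integrable_mul (φ := fun _ => 1) continuous_const (C := 1)
    fun v => by simp

theorem IsState.integrable_second_moment (hs : IsState W) (u : V) (i j : Fin 3) :
    Integrable fun v : V => (v i - u i) * (v j - u j) * (W v).1 := by
  refine hs.integrable_mul (C := 2 + 2 * ‖u‖ ^ 2) (by fun_prop) fun v => ?_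
  have h1 : |v i - u i| ≤ ‖v‖ + ‖u‖ := (PiLp.norm_apply_le (v - u) i).trans (norm_sub_le v u)
  have h2 : |v j - u j| ≤ ‖v‖ + ‖u‖ := (PiLp.norm_apply_le (v - u) j).trans (norm_sub_le v u)
  rw [abs_mul]
  have := mul_le_mul h1 h2 (abs_nonneg _) (by positivity)
  nlinarith [sq_nonneg (‖v‖ - ‖u‖), sq_nonneg (‖v‖ * ‖u‖)]

theorem integral_pos_of_pos {f : V → ℝ} (hf : ∀ v, 0 < f v) (hi : Integrable f) :
    0 < ∫ v, f v := by
  rw [integral_pos_iff_support_of_nonneg (fun v => (hf v).le) hi]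
  have : Function.support f = Set.univ := Set.eq_univ_of_forall fun v => (hf v).ne'
  rw [this]
  simp

theorem IsState.rho_pos (hs : IsState W) : 0 < rho W :=
  integral_pos_of_pos hs.F_pos hs.integrable_F

theorem IsState.hasMoments (hs : IsState W) :
    HasMoments W (rho W) (vel W) (Theta W) (energyRot W) (energyVib W) := by
  have hρ := hs.rho_pos.ne'
  refine ⟨hs.integrable_F, rfl, hs.integrable_second_moment _, fun i j => ?_, hs.G_int, ?_,
    hs.H_int, ?_⟩
  · simp only [Theta]; field_simp
  · simp only [energyRot]; field_simp
  · simp only [energyVib]; field_simp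

theorem IsState.energyRot_pos (hs : IsState W) : 0 < energyRot W :=
  mul_pos (one_div_pos.mpr hs.rho_pos) (integral_pos_of_pos hs.G_pos hs.G_int)

theorem IsState.energyVib_pos (hs : IsState W) : 0 < energyVib W :=
  mul_pos (one_div_pos.mpr hs.rho_pos) (integral_pos_of_pos hs.H_pos hs.H_int)

theorem IsState.trace_Theta (hs : IsState W) : (Theta W).trace = 2 * energyTr W := by
  have hi := hs.integrable_second_moment (vel W)
  simp only [Matrix.trace, Matrix.diag_apply, Theta, energyTr]
  rw [← Finset.mul_sum, ← integral_finsetSum _ fun i _ => hi i i]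
  have : ∀ v : V, 1 / 2 * ‖v - vel W‖ ^ 2 * (W v).1
      = 1 / 2 * ∑ i, (v i - vel W i) * (v i - vel W i) * (W v).1 := fun v => by
    rw [EuclideanSpace.norm_sq_eq, ← Finset.sum_mul, mul_assoc]
    simp only [norm_eq_abs, sq_abs, PiLp.sub_apply, ← sq]
  simp_rw [this]
  rw [integral_const_mul]
  ring

theorem IsState.posDef_Theta (hs : IsState W) : (Theta W).PosDef := by
  have hρ := hs.rho_pos
  refine Matrix.PosDef.of_dotProduct_mulVec_pos ?_ fun x hx => ?_
  · ext i j
    simp only [Matrix.conjTranspose_apply, star_trivial, Theta]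
    congr 2 with v
    ring
  · have hi := hs.integrable_second_moment (vel W)
    have hi' := fun i j => (hi i j).const_mul (x i * x j)
    have e : ∀ v : V, (∑ i, x i * (v i - vel W i)) ^ 2 * (W v).1
        = ∑ i, ∑ j, x i * x j * ((v i - vel W i) * (v j - vel W j) * (W v).1) := fun v => by
      rw [sq, Finset.sum_mul_sum, Finset.sum_mul]
      refine Finset.sum_congr rfl fun i _ => ?_
      rw [Finset.sum_mul]
      exact Finset.sum_congr rfl fun j _ => by ring
    have h1 : Integrable fun v : V => (∑ i, x i * (v i - vel W i)) ^ 2 * (W v).1 := by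
      simp_rw [e]
      exact integrable_finsetSum _ fun i _ => integrable_finsetSum _ fun j _ => hi' i j
    have h2 : star x ⬝ᵥ (Theta W).mulVec x
        = 1 / rho W * ∫ v : V, (∑ i, x i * (v i - vel W i)) ^ 2 * (W v).1 := by
      simp_rw [e]
      rw [integral_finsetSum _ fun i _ => integrable_finsetSum _ fun j _ => hi' i j]
      simp_rw [integral_finsetSum _ fun j _ => hi' _ j, integral_const_mul]
      simp only [dotProduct, Matrix.mulVec, Theta, star_trivial, Finset.mul_sum]
      exact Finset.sum_congr rfl fun i _ => Finset.sum_congr rfl fun j _ => by ring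
    rw [h2]
    refine mul_pos (one_div_pos.mpr hρ) (lt_of_le_of_ne
      (integral_nonneg fun v => mul_nonneg (sq_nonneg _) (hs.F_pos v).le) fun h0 => hx ?_)
    have h3 := (integral_eq_zero_iff_of_nonneg
      (fun v => mul_nonneg (sq_nonneg _) (hs.F_pos v).le) h1).mp h0.symm
    have h4 : (fun v : V => ∑ i, x i * (v i - vel W i)) =ᵐ[volume] fun _ => 0 := by
      filter_upwards [h3] with v hv
      simpa [(hs.F_pos v).ne'] using hv
    -- A degenerate direction `x` makes a continuous function vanish almost everywhere, hence
    -- everywhere; at $v=u+x$ its value is $x\cdot x$.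
    rw [Continuous.ae_eq_iff_eq volume (by fun_prop) (by fun_prop)] at h4
    have h5 := congrFun h4 (vel W + WithLp.toLp 2 x)
    simp only [PiLp.add_apply, add_sub_cancel_left] at h5
    exact dotProduct_self_eq_zero.mp h5

theorem IsState.energyTr_pos (hs : IsState W) : 0 < energyTr W := by
  have := hs.posDef_Theta.trace_pos
  rw [hs.trace_Theta] at this
  linarith

end State
end ESBGK

/-! ### Sign and zeros of the entropy production -/

namespace ESBGK

namespace Model

variable (P : Model) {W : V → ℝ × ℝ × ℝ}

theorem R_mul_Ttr : P.R * P.Ttr W = 2 / 3 * energyTr W := by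
  have := P.R_pos
  rw [Ttr, eTrInv]
  field_simp

theorem Ttr_pos (hs : IsState W) : 0 < P.Ttr W :=
  mul_pos (div_pos two_pos (mul_pos three_pos P.R_pos)) hs.energyTr_pos

theorem eRot_eq (T : ℝ) : P.eRot T = P.R * T := by rw [eRot, δ]; ring

theorem eRot_Trot : P.eRot (P.Trot W) = energyRot W := by
  have := P.R_pos
  rw [eRot_eq, Trot, eRotInv, δ]
  field_simp

theorem eVib_Tvib (hs : IsState W) : P.eVib (P.Tvib W) = energyVib W :=
  P.eVib_eVibInv hs.energyVib_pos

theorem eRotRel_eq :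
    P.eRotRel W = energyRot W + P.thetaRot W * (P.R * P.Ttr W - energyRot W) := by
  rw [eRotRel, eRot_Trot, eRot_eq]

theorem eVibRel_eq (hs : IsState W) :
    P.eVibRel W = energyVib W + P.thetaVib W * (P.eVib (P.Ttr W) - energyVib W) := by
  rw [eVibRel, P.eVib_Tvib hs]

theorem R_mul_TtrRel (hs : IsState W) : P.R * P.TtrRel W = P.R * P.Ttr W
    - 2 / 3 * (P.thetaRot W * (P.R * P.Ttr W - energyRot W)
      + P.thetaVib W * (P.eVib (P.Ttr W) - energyVib W)) := by
  have := P.R_pos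
  rw [TtrRel, eTrInv, eTrRel, eRot_Trot, eRot_eq, P.eVib_Tvib hs, eTr]
  field_simp
  ring

theorem tau_pos (hs : IsState W) (hPr : 0 < P.Pr) : 0 < P.tau W := by
  have h1 := hs.rho_pos
  have h2 := P.R_pos
  have h3 := P.Ttr_pos hs
  have h4 := P.μ_pos _ h3
  unfold tau
  positivity

theorem thetaRot_pos (hs : IsState W) (hPr : 0 < P.Pr) : 0 < P.thetaRot W :=
  div_pos (P.tau_pos hs hPr) (mul_pos (P.Zrot_pos _ (P.Ttr_pos hs))
    (P.τC_pos _ _ hs.rho_pos (P.Ttr_pos hs)))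

theorem thetaVib_pos (hs : IsState W) (hPr : 0 < P.Pr) : 0 < P.thetaVib W :=
  div_pos (P.tau_pos hs hPr) (mul_pos (P.Zvib_pos _ (P.Ttr_pos hs))
    (P.τC_pos _ _ hs.rho_pos (P.Ttr_pos hs)))

theorem relaxed_eq :
    P.relaxed W = gaussState (rho W) (vel W) (P.Pi W) (P.eRotRel W) (P.eVibRel W) := by
  have : ∀ v, P.Gtr W v = rho W * gaussianDensity (P.Pi W) (v - vel W).ofLp := fun v => by
    rw [Gtr, gaussianDensity]
    ring
  funext v
  rw [relaxed, gaussState, this]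

theorem equilibrium_eq (hT : 0 < P.Teq W) :
    P.equilibrium W = gaussState (rho W) (vel W)
      ((P.R * P.Teq W) • (1 : Matrix (Fin 3) (Fin 3) ℝ)) (P.eRot (P.Teq W)) (P.eVib (P.Teq W)) := by
  have hR := P.R_pos
  have hpos : 0 < P.R * P.Teq W := mul_pos hR hT
  have : ∀ v, P.Mtr W v = rho W * gaussianDensity
      ((P.R * P.Teq W) • (1 : Matrix (Fin 3) (Fin 3) ℝ)) (v - vel W).ofLp := fun v => by
    have h1 : ((2 * π) • (P.R * P.Teq W) • (1 : Matrix (Fin 3) (Fin 3) ℝ)).det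
        = (2 * π * P.R * P.Teq W) ^ 3 := by
      rw [smul_smul, Matrix.det_smul, Matrix.det_one]
      simp [mul_assoc]
    have h2 : √((2 * π * P.R * P.Teq W) ^ 3) = (2 * π * P.R * P.Teq W) ^ (3 / 2 : ℝ) := by
      rw [sqrt_eq_rpow, ← rpow_natCast, ← rpow_mul (by positivity)]
      norm_num
    have h3 : ((P.R * P.Teq W) • (1 : Matrix (Fin 3) (Fin 3) ℝ))⁻¹ = (P.R * P.Teq W)⁻¹ • 1 := by
      refine Matrix.inv_eq_left_inv ?_
      rw [Matrix.smul_mul, Matrix.one_mul, smul_smul, inv_mul_cancel₀ hpos.ne', one_smul]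
    have h4 : (v - vel W).ofLp ⬝ᵥ (v - vel W).ofLp = ‖v - vel W‖ ^ 2 := by
      rw [EuclideanSpace.norm_sq_eq]
      simp [dotProduct, sq]
    rw [Mtr, gaussianDensity, h1, h2, h3, Matrix.smul_mulVec, Matrix.one_mulVec, dotProduct_smul,
      h4, smul_eq_mul]
    have : -(‖v - vel W‖ ^ 2 / (2 * P.R * P.Teq W))
        = -(1 / 2) * ((P.R * P.Teq W)⁻¹ * ‖v - vel W‖ ^ 2) := by field_simp
    rw [this]
    ring
  funext v
  rw [equilibrium, gaussState, this]

theorem Pr_pos (hc : P.Conditions W) : 0 < P.Pr := lt_trans (by norm_num) hc.Pr_lower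

theorem eRotRel_pos (hs : IsState W) (hc : P.Conditions W) : 0 < P.eRotRel W := by
  have h1 := P.thetaRot_pos hs (P.Pr_pos hc)
  have h2 := hs.energyRot_pos
  have h3 := mul_pos P.R_pos (P.Ttr_pos hs)
  have h4 := hc.rot_lt
  rw [eRotRel_eq]
  nlinarith [mul_pos h1 h3]

theorem eVibRel_pos (hs : IsState W) (hc : P.Conditions W) : 0 < P.eVibRel W := by
  have h1 := P.thetaVib_pos hs (P.Pr_pos hc)
  have h2 := hs.energyVib_pos
  have h3 := P.eVib_pos (P.Ttr_pos hs)
  have h4 := hc.vib_lt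
  rw [P.eVibRel_eq hs]
  nlinarith [mul_pos h1 h3]

/-- Multiplied by $RT_{tr}$, the second bound on $\kappa$ gives $RT_{tr}^{rel}+2\nu RT_{tr}>0$ with
$\nu=(\mathrm{Pr}-1)/\mathrm{Pr}$, once the positive energies $E_{rot},E_{vib}$ are dropped and
$e_{vib}\le Tc_v^{vib}$ is used. This is the hypothesis of `posDef_and_det_le`. -/
theorem Pi_posDef_and_det_le (hs : IsState W) (hc : P.Conditions W) : (P.Pi W).PosDef ∧
    (P.R * P.TtrRel W / (P.R * P.Ttr W)) ^ 3 * (Theta W).det ≤ (P.Pi W).det ∧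
    0 < P.R * P.TtrRel W := by
  have hPr := P.Pr_pos hc
  have hT := P.Ttr_pos hs
  have hR := P.R_pos
  have hL := mul_pos hR hT
  have hr := P.thetaRot_pos hs hPr
  have hv := P.thetaVib_pos hs hPr
  have hν : (P.Pr - 1) / P.Pr ≤ 0 := div_nonpos_of_nonpos_of_nonneg
    (by linarith [hc.Pr_upper]) hPr.le
  have hκ := hc.Pi_lt
  rw [cvRot_eq, cvTr_eq] at hκ
  have e1 : P.R * P.Ttr W * (P.thetaRot W * (P.R / (3 / 2 * P.R))
        + P.thetaVib W * (P.cvVib (P.Ttr W) / (3 / 2 * P.R)))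
      = 2 / 3 * (P.thetaRot W * (P.R * P.Ttr W)
        + P.thetaVib W * (P.Ttr W * P.cvVib (P.Ttr W))) := by
    field_simp
  have e2 : P.R * P.Ttr W * (3 / P.Pr * (P.Pr - 2 / 3))
      = P.R * P.Ttr W + 2 * ((P.Pr - 1) / P.Pr * (P.R * P.Ttr W)) := by
    field_simp; ring
  have h1 := mul_lt_mul_of_pos_left hκ hL
  rw [e1, e2] at h1
  have h2 := mul_le_mul_of_nonneg_left (P.eVib_le_mul_cvVib hT) hv.le
  have h3 := mul_pos hr hs.energyRot_pos
  have h4 := mul_pos hv hs.energyVib_pos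
  have h5 : 0 < P.R * P.TtrRel W + 2 * ((P.Pr - 1) / P.Pr * (P.R * P.Ttr W)) := by
    rw [P.R_mul_TtrRel hs]
    nlinarith
  have htr : (Theta W).trace = 3 * (P.R * P.Ttr W) := by
    rw [hs.trace_Theta, R_mul_Ttr]; ring
  obtain ⟨a1, a2⟩ := posDef_and_det_le hs.posDef_Theta hL htr hν h5
  exact ⟨a1, a2, by nlinarith⟩

/-- The determinant bound exchanges $\frac12\log\det\Theta$ for the isotropic term $\frac32\log
T_{tr}$; `entropy_le_relax` treats what remains. -/
theorem gaussEntropy_relaxed_le (hs : IsState W) (hc : P.Conditions W) :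
    gaussEntropy P.vibScale (P.Pi W) (P.eRotRel W) (P.eVibRel W)
      ≤ gaussEntropy P.vibScale (Theta W) (energyRot W) (energyVib W) := by
  have hPr := P.Pr_pos hc
  have hL := mul_pos P.R_pos (P.Ttr_pos hs)
  obtain ⟨h1, h2, h3⟩ := P.Pi_posDef_and_det_le hs hc
  have hdet := hs.posDef_Theta.det_pos
  have h4 := log_le_log (by positivity) h2
  rw [log_mul (by positivity) hdet.ne', log_pow, log_div h3.ne' hL.ne'] at h4
  have h5 := entropy_le_relax P.vibScale_pos hL hs.energyRot_pos hs.energyVib_pos rfl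
    (P.thetaRot_pos hs hPr).le (P.thetaVib_pos hs hPr).le hc.sum_le
  rw [← P.eVib_eq, ← P.eRotRel_eq, ← P.eVibRel_eq hs, ← P.R_mul_TtrRel hs] at h5
  simp only [gaussEntropy]
  push_cast at h4
  linarith

/-- Only the sum with `B` is shown integrable: the moments of `W` control neither `B` nor the
production density alone. Keeping `B` also gives access to the equality case. -/
theorem integral_productionDensity_add (hs : IsState W) (hc : P.Conditions W) :
    ∃ B : V → ℝ, (∀ v, P.bregman (P.relaxed W v) (W v) ≤ B v) ∧
      Integrable (fun v => P.tau W * P.productionDensity W v + B v) ∧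
      ∫ v, (P.tau W * P.productionDensity W v + B v) ≤ 0 := by
  have hτ := P.tau_pos hs (P.Pr_pos hc)
  have hρ := hs.rho_pos
  have hΘ := hs.posDef_Theta
  have hPi := (P.Pi_posDef_and_det_le hs hc).1
  have hr := P.eRotRel_pos hs hc
  have hv := P.eVibRel_pos hs hc
  set E := gaussState (rho W) (vel W) (Theta W) (energyRot W) (energyVib W) with hE
  set g := gaussState (rho W) (vel W) (P.Pi W) (P.eRotRel W) (P.eVibRel W) with hg
  have hEo : ∀ v, E v ∈ octant :=
    gaussState_mem_octant hρ _ hΘ hs.energyRot_pos hs.energyVib_pos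
  have hgo : ∀ v, g v ∈ octant := gaussState_mem_octant hρ _ hPi hr hv
  have hWo : ∀ v, W v ∈ octant := fun v => ⟨hs.F_pos v, hs.G_pos v, hs.H_pos v⟩
  have mg := hasMoments_gaussState (rho W) (vel W) hPi (P.eRotRel W) (P.eVibRel W)
  have mE := hasMoments_gaussState (rho W) (vel W) hΘ (energyRot W) (energyVib W)
  obtain ⟨i1, e1⟩ := P.integral_fderiv_h_gaussState hρ hPi hr hv mg
  obtain ⟨i2, e2⟩ := P.integral_fderiv_h_gaussState hρ hΘ hs.energyRot_pos hs.energyVib_pos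
    hs.hasMoments
  rw [← hE, ← hg] at *
  -- All terms $h(W)$ and $Dh(W)$ cancel, leaving differentials at Gaussian states only.
  have key : ∀ v, P.tau W * P.productionDensity W v
      + (P.bregman (g v) (W v) + P.bregman (W v) (E v))
      = fderiv ℝ P.h (g v) (g v) - (g v).1 - fderiv ℝ P.h (E v) (W v) + (E v).1 := fun v => by
    have h1 := P.fderiv_h_self (hgo v)
    have h2 := P.fderiv_h_self (hEo v)
    simp only [productionDensity, collision, relaxed_eq, map_smul, smul_eq_mul, bregman,
      map_sub] at *
    field_simp
    linarith
  refine ⟨fun v => P.bregman (g v) (W v) + P.bregman (W v) (E v), fun v => ?_, ?_, ?_⟩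
  · rw [relaxed_eq, ← hg]
    linarith [P.bregman_nonneg (hEo v) (hWo v)]
  · simp_rw [key]
    exact ((i1.sub mg.F_int).sub i2).add mE.F_int
  · simp_rw [key]
    rw [integral_sub_sub_add i1 mg.F_int i2 mE.F_int, e1, e2, mg.F_eq, mE.F_eq]
    have := mul_le_mul_of_nonneg_left (P.gaussEntropy_relaxed_le hs hc) hρ.le
    linarith

theorem production_le_and (hs : IsState W) (hc : P.Conditions W)
    (hi : Integrable (P.productionDensity W)) :
    P.production W ≤ 0 ∧ (P.production W = 0 → W =ᵐ[volume] P.relaxed W) := by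
  have hτ := P.tau_pos hs (P.Pr_pos hc)
  obtain ⟨B, hB, hBi, hle⟩ := P.integral_productionDensity_add hs hc
  have hWo : ∀ v, W v ∈ octant := fun v => ⟨hs.F_pos v, hs.G_pos v, hs.H_pos v⟩
  have hgo : ∀ v, P.relaxed W v ∈ octant := by
    rw [relaxed_eq]
    exact gaussState_mem_octant hs.rho_pos _ (P.Pi_posDef_and_det_le hs hc).1
      (P.eRotRel_pos hs hc) (P.eVibRel_pos hs hc)
  have hb := fun v => P.bregman_nonneg (hWo v) (hgo v)
  have hB0 : ∀ v, 0 ≤ B v := fun v => (hb v).trans (hB v)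
  have hi' := hi.const_mul (P.tau W)
  -- Integrability of the production density is what separates `B` from the sum.
  have iB : Integrable B := (hBi.sub hi').congr (ae_of_all _ fun v => add_sub_cancel_left _ _)
  rw [integral_add hi' iB, integral_const_mul] at hle
  have h0 : 0 ≤ ∫ v, B v := integral_nonneg hB0
  change P.tau W * P.production W + _ ≤ 0 at hle
  refine ⟨nonpos_of_mul_nonpos_right (by linarith) hτ, fun h => ?_⟩
  rw [h, mul_zero, zero_add] at hle
  filter_upwards [(integral_eq_zero_iff_of_nonneg hB0 iB).mp (le_antisymm hle h0)] with v hv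
  exact (P.eq_of_bregman_eq_zero (hWo v) (hgo v)
    (le_antisymm ((hB v).trans (le_of_eq hv)) (hb v))).symm

theorem eq_equilibrium_of_eq_relaxed (hs : IsState W) (hc : P.Conditions W)
    (h : W =ᵐ[volume] P.relaxed W) :
    W =ᵐ[volume] P.equilibrium W := by
  have hPr := P.Pr_pos hc
  have hR := P.R_pos
  have hT := P.Ttr_pos hs
  have hm := hasMoments_gaussState (rho W) (vel W) (P.Pi_posDef_and_det_le hs hc).1
    (P.eRotRel W) (P.eVibRel W)
  rw [← relaxed_eq] at hm
  obtain ⟨h1, h2, h3⟩ := hs.hasMoments.unique hs.rho_pos.ne' (hm.congr h.symm)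
  have k2 : P.R * P.Ttr W = energyRot W := by
    rw [eRotRel_eq] at h2
    have : P.thetaRot W * (P.R * P.Ttr W - energyRot W) = 0 := by linarith
    linarith [(mul_eq_zero.mp this).resolve_left (P.thetaRot_pos hs hPr).ne']
  have k3 : P.eVib (P.Ttr W) = energyVib W := by
    rw [P.eVibRel_eq hs] at h3
    have : P.thetaVib W * (P.eVib (P.Ttr W) - energyVib W) = 0 := by linarith
    linarith [(mul_eq_zero.mp this).resolve_left (P.thetaVib_pos hs hPr).ne']
  have k4 : P.R * P.TtrRel W = P.R * P.Ttr W := by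
    rw [P.R_mul_TtrRel hs, k2, k3]; ring
  -- The total energy is $e(T_{tr})$, so injectivity of $e$ suffices to identify `Teq`.
  have k5 : P.Teq W = P.Ttr W := by
    have : energyTr W + energyRot W + energyVib W = P.eTot (P.Ttr W) := by
      rw [eTot, eRot_eq, k2, k3, eTr, mul_assoc, R_mul_Ttr]
      ring
    rw [Teq, this, P.eTotInv_eTot hT]
  have k6 : P.Pi W = (P.R * P.Ttr W) • (1 : Matrix (Fin 3) (Fin 3) ℝ) := by
    -- With $T_{tr}^{rel}=T_{tr}$, the equation $\Theta=\Pi$ reads $(1-\nu)(\Theta-RT_{tr}I)=0$,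
    -- where $1-\nu=1/\mathrm{Pr}$.
    have e : (1 / P.Pr) • (Theta W - (P.R * P.Ttr W) • (1 : Matrix (Fin 3) (Fin 3) ℝ)) = 0 := by
      have e0 : 1 / P.Pr = 1 - (P.Pr - 1) / P.Pr := by field_simp; ring
      rw [e0, sub_smul, one_smul]
      conv_lhs => enter [1, 1]; rw [h1, Pi, k4]
      abel
    rw [smul_eq_zero_iff_right (one_div_pos.mpr hPr).ne'] at e
    rw [← h1]
    exact sub_eq_zero.mp e
  have e : P.equilibrium W = P.relaxed W := by
    rw [P.equilibrium_eq (k5 ▸ hT), relaxed_eq, k5, k6, ← h2, ← h3, eRot_eq, k2, k3]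
  rwa [e]

theorem eq_relaxed_of_eq_equilibrium (hs : IsState W) (h : W =ᵐ[volume] P.equilibrium W) :
    P.relaxed W = P.equilibrium W := by
  have hR := P.R_pos
  -- Positivity of `Teq` is read off from a velocity where `W` equals the equilibrium triple, since
  -- both `F` and `G` are positive there.
  have hT : 0 < P.Teq W := by
    obtain ⟨v, hv⟩ := h.exists
    have h1 := hs.F_pos v
    have h2 := hs.G_pos v
    rw [hv] at h1 h2
    have h3 := pos_of_mul_pos_left h2 h1.le
    rw [eRot_eq] at h3
    exact pos_of_mul_pos_right h3 hR.le
  have hpos : 0 < P.R * P.Teq W := mul_pos hR hT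
  have hm := hasMoments_gaussState (rho W) (vel W) (Matrix.PosDef.one.smul hpos)
    (P.eRot (P.Teq W)) (P.eVib (P.Teq W))
  rw [← P.equilibrium_eq hT] at hm
  obtain ⟨h1, h2, h3⟩ := hs.hasMoments.unique hs.rho_pos.ne' (hm.congr h.symm)
  have k1 : P.Ttr W = P.Teq W := by
    have := hs.trace_Theta
    rw [h1, Matrix.trace_smul, Matrix.trace_one] at this
    have k := P.R_mul_Ttr (W := W)
    simp only [Fintype.card_fin, smul_eq_mul] at this
    push_cast at this
    exact mul_left_cancel₀ hR.ne' (by linarith)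
  have k2 : P.eRotRel W = P.eRot (P.Teq W) := by
    rw [eRotRel_eq, h2, k1, eRot_eq]; ring
  have k3 : P.eVibRel W = P.eVib (P.Teq W) := by
    rw [P.eVibRel_eq hs, h3, k1]; ring
  have k4 : P.R * P.TtrRel W = P.R * P.Teq W := by
    rw [P.R_mul_TtrRel hs, h2, h3, k1, eRot_eq]; ring
  have k5 : P.Pi W = (P.R * P.Teq W) • (1 : Matrix (Fin 3) (Fin 3) ℝ) := by
    rw [Pi, k4, h1, k1, sub_self, smul_zero, add_zero]
  rw [relaxed_eq, P.equilibrium_eq hT, k2, k3, k5]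

/-- Sign of the entropy production and characterization of its zeros. -/
theorem production_nonpos_and_eq_zero_iff (hs : IsState W) (hc : P.Conditions W)
    (hi : Integrable (P.productionDensity W)) :
    P.production W ≤ 0 ∧ (P.production W = 0 ↔ W =ᵐ[volume] P.equilibrium W) := by
  obtain ⟨h1, h2⟩ := P.production_le_and hs hc hi
  refine ⟨h1, fun h => P.eq_equilibrium_of_eq_relaxed hs hc (h2 h), fun h => ?_⟩
  have e := P.eq_relaxed_of_eq_equilibrium hs h
  refine (integral_congr_ae (g := fun _ => (0 : ℝ)) ?_).trans (integral_zero _ _)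
  filter_upwards [h] with v hv
  simp [productionDensity, collision, e, ← hv]

end Model
end ESBGK

/-! ### Differentiation under the integral and the local entropy balance -/

namespace ESBGK

/-- A derivative is a limit of difference quotients. Those with non-measurable `f s` are replaced by
zero, which does not change the limit. -/
theorem aestronglyMeasurable_of_hasDerivAt {f : ℝ → V → ℝ} {f' : V → ℝ} {t : ℝ}
    (hm : ∀ᶠ s in 𝓝 t, AEStronglyMeasurable (f s) volume)
    (hd : ∀ v, HasDerivAt (f · v) (f' v) t) : AEStronglyMeasurable f' volume := by
  classical
  have hmt : AEStronglyMeasurable (f t) volume := hm.self_of_nhds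
  refine aestronglyMeasurable_of_tendsto_ae (𝓝[≠] t)
    (f := fun s v => if AEStronglyMeasurable (f s) volume then slope (f · v) t s else 0)
    (fun s => ?_) (ae_of_all _ fun v => ?_)
  · by_cases h : AEStronglyMeasurable (f s) volume
    · simp only [h, if_true, slope, vsub_eq_sub, smul_eq_mul]
      exact (h.sub hmt).const_mul _
    · simp only [h, if_false]
      exact aestronglyMeasurable_const
  · refine (hasDerivAt_iff_tendsto_slope.mp (hd v)).congr' ?_
    filter_upwards [hm.filter_mono nhdsWithin_le_nhds] with s hs
    rw [if_pos hs]

theorem eq_sum_smul_single (w : V) :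
    w = ∑ i : Fin 3, w i • (EuclideanSpace.single i (1 : ℝ) : V) := by
  ext j
  simp [Pi.single_apply]

theorem smulRight_eq_sum (L : V →L[ℝ] ℝ) (v : V) :
    L.smulRight v = ∑ i : Fin 3,
      L (EuclideanSpace.single i 1) • (EuclideanSpace.proj i : V →L[ℝ] ℝ).smulRight v := by
  ext1 w
  conv_lhs => rw [eq_sum_smul_single w]
  simp only [ContinuousLinearMap.smulRight_apply, map_sum, map_smul,
    sum_apply, smul_apply, smul_smul]
  exact Finset.sum_congr rfl fun i _ => by rw [mul_comm]; rfl

/-- The operator is a sum over coordinate directions of a partial derivative, measurable by the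
one-parameter lemma, times an operator continuous in `v`. -/
theorem aestronglyMeasurable_smulRight_of_hasFDerivAt {f : V → V → ℝ} {f' : V → V →L[ℝ] ℝ} {x : V}
    (hm : ∀ᶠ y in 𝓝 x, AEStronglyMeasurable (f y) volume)
    (hd : ∀ v, HasFDerivAt (f · v) (f' v) x) :
    AEStronglyMeasurable (fun v => (f' v).smulRight v) volume := by
  rw [funext fun v => smulRight_eq_sum (f' v) v]
  refine Finset.aestronglyMeasurable_fun_sum _ fun i _ => ?_
  have hl : HasDerivAt (fun s : ℝ => x + s • (EuclideanSpace.single i (1 : ℝ) : V))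
      (EuclideanSpace.single i (1 : ℝ)) 0 := by
    simpa using ((hasDerivAt_id (0 : ℝ)).smul_const (EuclideanSpace.single i (1 : ℝ) : V)).const_add x
  have h0 : x + (0 : ℝ) • (EuclideanSpace.single i (1 : ℝ) : V) = x := by simp
  have h1 : AEStronglyMeasurable (fun v => f' v (EuclideanSpace.single i 1)) volume := by
    refine aestronglyMeasurable_of_hasDerivAt (t := 0)
      (f := fun s => f (x + s • (EuclideanSpace.single i (1 : ℝ) : V))) ?_ fun v => ?_
    · exact hl.continuousAt.eventually (by simp only [h0]; exact hm)
    · exact HasFDerivAt.comp_hasDerivAt (0 : ℝ) (by simp only [h0]; exact hd v) hl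
  have h2 : Continuous fun v : V => (EuclideanSpace.proj i : V →L[ℝ] ℝ).smulRight v :=
    (ContinuousLinearMap.smulRightL ℝ V V (EuclideanSpace.proj i)).continuous
  exact h1.smul h2.aestronglyMeasurable

namespace Model

variable {P : Model} {U : Set (ℝ × V)} {W : ℝ → V → V → ℝ × ℝ × ℝ}

theorem IsSolution.hasFDerivAt_h (hW : P.IsSolution U W) {t : ℝ} {x : V} (hU : (t, x) ∈ U) (v : V) :
    HasFDerivAt (fun q : ℝ × V => P.h (W q.1 q.2 v))
      ((fderiv ℝ P.h (W t x v)).comp (fderiv ℝ (fun q : ℝ × V => W q.1 q.2 v) (t, x))) (t, x) := by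
  have hs := hW.state t x hU
  have ho : W t x v ∈ octant := ⟨hs.F_pos v, hs.G_pos v, hs.H_pos v⟩
  exact (P.differentiableAt_h ho).hasFDerivAt.comp (t, x) (hW.diff t x hU v).hasFDerivAt

theorem hasDerivAt_of_hasFDerivAt_prod {E : Type*} [NormedAddCommGroup E] [NormedSpace ℝ E]
    {f : ℝ × V → E} {L : ℝ × V →L[ℝ] E} {t : ℝ} {x : V} (h : HasFDerivAt f L (t, x)) :
    HasDerivAt (fun s => f (s, x)) (L (1, 0)) t :=
  h.comp_hasDerivAt t ((hasDerivAt_id t).prodMk (hasDerivAt_const t x))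

theorem hasFDerivAt_of_hasFDerivAt_prod {E : Type*} [NormedAddCommGroup E] [NormedSpace ℝ E]
    {f : ℝ × V → E} {L : ℝ × V →L[ℝ] E} {t : ℝ} {x : V} (h : HasFDerivAt f L (t, x)) :
    HasFDerivAt (fun y => f (t, y)) (L.comp (ContinuousLinearMap.inr ℝ ℝ V)) x :=
  h.comp x (hasFDerivAt_prodMk_right t x)

theorem IsSolution.hasDerivAt_time (hW : P.IsSolution U W) {t : ℝ} {x : V} (hU : (t, x) ∈ U)
    (v : V) : HasDerivAt (fun s => P.h (W s x v)) (deriv (fun s => P.h (W s x v)) t) t :=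
  (hasDerivAt_of_hasFDerivAt_prod (hW.hasFDerivAt_h hU v)).differentiableAt.hasDerivAt

theorem IsSolution.hasFDerivAt_space (hW : P.IsSolution U W) {t : ℝ} {x : V} (hU : (t, x) ∈ U)
    (v : V) : HasFDerivAt (fun y => P.h (W t y v)) (fderiv ℝ (fun y => P.h (W t y v)) x) x :=
  (hasFDerivAt_of_hasFDerivAt_prod (hW.hasFDerivAt_h hU v)).differentiableAt.hasFDerivAt

/-- The transport of the entropy density along a solution is the production density. -/
theorem IsSolution.productionDensity_eq (hW : P.IsSolution U W) {t : ℝ} {x : V} (hU : (t, x) ∈ U)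
    (v : V) : P.productionDensity (W t x) v
      = deriv (fun s => P.h (W s x v)) t + fderiv ℝ (fun y => P.h (W t y v)) x v := by
  have h1 := hW.hasFDerivAt_h hU v
  have h2 := (hW.diff t x hU v).hasFDerivAt
  have e1 := (hasDerivAt_of_hasFDerivAt_prod h1).deriv
  have e2 := (hasFDerivAt_of_hasFDerivAt_prod h1).fderiv
  have e3 := (hasDerivAt_of_hasFDerivAt_prod h2).deriv
  have e4 := (hasFDerivAt_of_hasFDerivAt_prod h2).fderiv
  simp only at e1 e2 e3 e4
  rw [productionDensity, ← hW.eqn t x hU v, e1, e2, e3, e4, map_add]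
  rfl

theorem EntropyRegular.integrable_h (hr : P.EntropyRegular U W) {t : ℝ} {x : V} (hU : (t, x) ∈ U) :
    Integrable fun v => P.h (W t x v) := by
  have h1 : Continuous fun v : V => (1 + ‖v‖)⁻¹ :=
    Continuous.inv₀ (by fun_prop) fun v => by positivity
  refine ((hr.integrable t x hU).bdd_mul (c := 1) h1.aestronglyMeasurable
    (ae_of_all _ fun v => ?_)).congr (ae_of_all _ fun v => ?_)
  · rw [norm_inv, norm_of_nonneg (by positivity)]
    exact inv_le_one_of_one_le₀ (by linarith [norm_nonneg v])
  · have : 1 + ‖v‖ ≠ 0 := by positivity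
    field_simp

theorem EntropyRegular.integrable_h_smul (hr : P.EntropyRegular U W) {t : ℝ} {x : V}
    (hU : (t, x) ∈ U) : Integrable fun v => P.h (W t x v) • v := by
  refine (hr.integrable t x hU).mono
    ((hr.integrable_h hU).aestronglyMeasurable.smul continuous_id.aestronglyMeasurable)
    (ae_of_all _ fun v => ?_)
  rw [norm_smul, norm_mul, mul_comm, norm_of_nonneg (show 0 ≤ 1 + ‖v‖ by positivity)]
  gcongr
  linarith

theorem hasDerivAt_entropy (hO : IsOpen U) (hW : P.IsSolution U W) (hr : P.EntropyRegular U W)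
    {t : ℝ} {x : V} (hU : (t, x) ∈ U) :
    Integrable (fun v => deriv (fun s => P.h (W s x v)) t) ∧
    HasDerivAt (fun s => P.entropy (W s x)) (∫ v, deriv (fun s => P.h (W s x v)) t) t := by
  obtain ⟨N, hN, g, hg, hb⟩ := hr.dominated _ hU
  have hc : ContinuousAt (fun s : ℝ => (s, x)) t := by fun_prop
  have hs : {s : ℝ | (s, x) ∈ U ∩ N} ∈ 𝓝 t := hc (Filter.inter_mem (hO.mem_nhds hU) hN)
  have hm : ∀ᶠ s in 𝓝 t, AEStronglyMeasurable (fun v => P.h (W s x v)) volume := by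
    filter_upwards [hs] with s hs using (hr.integrable_h hs.1).aestronglyMeasurable
  refine hasDerivAt_integral_of_dominated_loc_of_deriv_le
    (F := fun s v => P.h (W s x v)) (F' := fun s v => deriv (fun s => P.h (W s x v)) s) hs hm
    (hr.integrable_h hU) (aestronglyMeasurable_of_hasDerivAt hm fun v => hW.hasDerivAt_time hU v)
    (ae_of_all _ fun v s hs => ?_) hg (ae_of_all _ fun v s hs => hW.hasDerivAt_time hs.1 v)
  refine le_trans ?_ (hb s x hs.2 v)
  rw [norm_eq_abs]
  exact le_add_of_nonneg_right (by positivity)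

theorem hasFDerivAt_entropyFlux (hO : IsOpen U) (hW : P.IsSolution U W)
    (hr : P.EntropyRegular U W) {t : ℝ} {x : V} (hU : (t, x) ∈ U) :
    Integrable (fun v => (fderiv ℝ (fun y => P.h (W t y v)) x).smulRight v) ∧
    HasFDerivAt (fun y => P.entropyFlux (W t y))
      (∫ v, (fderiv ℝ (fun y => P.h (W t y v)) x).smulRight v) x := by
  obtain ⟨N, hN, g, hg, hb⟩ := hr.dominated _ hU
  have hc : ContinuousAt (fun y : V => (t, y)) x := by fun_prop
  have hs : {y : V | (t, y) ∈ U ∩ N} ∈ 𝓝 x := hc (Filter.inter_mem (hO.mem_nhds hU) hN)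
  have hm : ∀ᶠ y in 𝓝 x, AEStronglyMeasurable (fun v => P.h (W t y v)) volume := by
    filter_upwards [hs] with y hy using (hr.integrable_h hy.1).aestronglyMeasurable
  have hm' : ∀ᶠ y in 𝓝 x, AEStronglyMeasurable (fun v => P.h (W t y v) • v) volume := by
    filter_upwards [hs] with y hy using (hr.integrable_h_smul hy.1).aestronglyMeasurable
  have hmd := aestronglyMeasurable_smulRight_of_hasFDerivAt (f := fun y v => P.h (W t y v)) hm
    fun v => hW.hasFDerivAt_space hU v
  have hbd : ∀ v, ∀ y ∈ {y : V | (t, y) ∈ U ∩ N},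
      ‖(fderiv ℝ (fun y => P.h (W t y v)) y).smulRight v‖ ≤ g v := fun v y hy => by
    rw [ContinuousLinearMap.norm_smulRight_apply, mul_comm]
    exact le_trans (le_add_of_nonneg_left (abs_nonneg _)) (hb t y hy.2 v)
  refine ⟨hg.mono' hmd (ae_of_all _ fun v => hbd v x (mem_of_mem_nhds hs)), ?_⟩
  exact hasFDerivAt_integral_of_dominated_of_fderiv_le
    (F := fun y v => P.h (W t y v) • v)
    (F' := fun y v => (fderiv ℝ (fun y => P.h (W t y v)) y).smulRight v) hs hm'
    (hr.integrable_h_smul hU) hmd (ae_of_all _ hbd) hg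
    (ae_of_all _ fun v y hy => (hW.hasFDerivAt_space hy.1 v).smul_const v)

theorem sum_smulRight_single (L : V →L[ℝ] ℝ) (v : V) :
    ∑ j : Fin 3, (L.smulRight v (EuclideanSpace.single j 1)) j = L v := by
  conv_rhs => rw [eq_sum_smul_single v]
  simp only [map_sum, map_smul, ContinuousLinearMap.smulRight_apply, PiLp.smul_apply, smul_eq_mul]
  exact Finset.sum_congr rfl fun i _ => mul_comm _ _

/-- The divergence is the trace of the derivative, and the trace of $L\otimes v$ is $L(v)$; the
trace commutes with the integral. -/
theorem divergence_eq_integral {q : V → V} {x : V} {L : V → V →L[ℝ] ℝ}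
    (hi : Integrable fun v => (L v).smulRight v)
    (h : HasFDerivAt q (∫ v, (L v).smulRight v) x) :
    Integrable (fun v => L v v) ∧ divergence q x = ∫ v, L v v := by
  have h1 : ∀ j : Fin 3, Integrable fun v => (L v).smulRight v (EuclideanSpace.single j 1) :=
    fun j => hi.apply_continuousLinearMap _
  have h2 : ∀ j : Fin 3, Integrable fun v => ((L v).smulRight v (EuclideanSpace.single j 1)) j :=
    fun j => (EuclideanSpace.proj j : V →L[ℝ] ℝ).integrable_comp (h1 j)
  simp_rw [← sum_smulRight_single]
  refine ⟨integrable_finsetSum _ fun j _ => h2 j, ?_⟩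
  rw [integral_finsetSum _ fun j _ => h2 j, divergence, h.fderiv]
  refine Finset.sum_congr rfl fun j _ => ?_
  rw [ContinuousLinearMap.integral_apply hi]
  exact ((EuclideanSpace.proj j : V →L[ℝ] ℝ).integral_comp_comm (h1 j)).symm

end Model
end ESBGK

theorem mainTheorem7 (P : ESBGK.Model) :
    -- the entropy density is convex
    ConvexOn ℝ {p : ℝ × ℝ × ℝ | 0 < p.1 ∧ 0 < p.2.1 ∧ 0 < p.2.2} P.h ∧
    -- sign of the entropy production and its zeros, for any reduced state
    (∀ W : ESBGK.V → ℝ × ℝ × ℝ, ESBGK.IsState W → P.Conditions W →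
      Integrable (P.productionDensity W) →
        P.production W ≤ 0 ∧ (P.production W = 0 ↔ W =ᵐ[volume] P.equilibrium W)) ∧
    -- local entropy balance along solutions
    (∀ (U : Set (ℝ × ESBGK.V)) (W : ℝ → ESBGK.V → ESBGK.V → ℝ × ℝ × ℝ), IsOpen U →
      P.IsSolution U W → P.EntropyRegular U W →
      (∀ t x, (t, x) ∈ U → P.Conditions (W t x)) →
      ∀ t x, (t, x) ∈ U →
        DifferentiableAt ℝ (fun s => P.entropy (W s x)) t ∧
        DifferentiableAt ℝ (fun y => P.entropyFlux (W t y)) x ∧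
        Integrable (P.productionDensity (W t x)) ∧
        deriv (fun s => P.entropy (W s x)) t
            + ESBGK.divergence (fun y => P.entropyFlux (W t y)) x
          = P.production (W t x) ∧
        P.production (W t x) ≤ 0 ∧
        (P.production (W t x) = 0 ↔ W t x =ᵐ[volume] P.equilibrium (W t x))) := by
  refine ⟨P.convexOn_h, fun W hs hc hi => P.production_nonpos_and_eq_zero_iff hs hc hi, ?_⟩
  intro U W hO hW hr hc t x hU
  obtain ⟨i1, d1⟩ := ESBGK.Model.hasDerivAt_entropy hO hW hr hU
  obtain ⟨i2, d2⟩ := ESBGK.Model.hasFDerivAt_entropyFlux hO hW hr hU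
  obtain ⟨i3, e3⟩ := ESBGK.Model.divergence_eq_integral i2 d2
  -- Along a solution the production density is the transport derivative of $h$, so its
  -- integrability follows from the domination and need not be assumed.
  have e : P.productionDensity (W t x) = fun v => deriv (fun s => P.h (W s x v)) t
      + fderiv ℝ (fun y => P.h (W t y v)) x v := funext (hW.productionDensity_eq hU)
  have hi : Integrable (P.productionDensity (W t x)) := e ▸ i1.add i3
  obtain ⟨p1, p2⟩ := P.production_nonpos_and_eq_zero_iff (hW.state t x hU) (hc t x hU) hi
  refine ⟨d1.differentiableAt, d2.differentiableAt, hi, ?_, p1, p2⟩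
  rw [d1.deriv, e3, ← integral_add i1 i3, ESBGK.Model.production, e]
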